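/- Let $X$ be a smooth finite-dimensional Riemannian manifold (without boundary) with Riemannian distance $\mathrm{dist}$ and Levi-Civita connection $\nabla$, and let $\phi$ be a calibration on $X$ of degree $p\ge 1$, that is, a smooth closed $p$-form with $\phi(\xi)\le 1$ for every unit simple tangent $p$-vector $\xi=e_1\wedge\dots\wedge e_p$ ($e_1,\dots,e_p$ orthonormal). A $\phi$-plane at $x$ is a unit simple $p$-vector $\xi$ at $x$ with $\phi(\xi)=1$. For a function $f$ that is smooth near $x$, let $\mathrm{Hess}_xf:T_xX\to T_xX$, $V\mapsto\nabla_V(\nabla f)$, be its Riemannian Hessian and let $\mathcal H^\phi(f)=\lambda_\phi(\mathrm{Hess} f)$ be its $\phi$-Hessian, where $\lambda_\phi(A)(v_1,\dots,v_p)=\sum_i\phi(v_1,\dots,Av_i,\dots,v_p)$. The function $f$ is strictly $\phi$-plurisubharmonic at $x$ if it is smooth near $x$ and $\mathcal H^\phi(f)(\xi)>0$ for every $\phi$-plane $\xi$ at $x$. Let $M\subset X$ be a closed submanifold (a smoothly embedded manifold without boundary that is a closed subset, not necessarily compact), and put $f_M(x)=\tfrac12\,\mathrm{dist}(x,M)^2$.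 Call $M$ $\phi$-free if there are no $x\in M$ and no $\phi$-plane $\xi$ at $x$ with $\mathrm{span}\,\xi\subset T_xM$. Then: 1. $f_M$ is $C^\infty$ on an open neighborhood of $M$, and for each $x\in M$ one has $\mathrm{Hess}_xf_M=P_N$, the orthogonal projection of $T_xX$ onto the normal space $N=(T_xM)^\perp$. 2. $M$ is $\phi$-free if and only if $f_M$ is strictly $\phi$-plurisubharmonic at each point of $M$. 3. $M$ is $\phi$-free if and only if $f_M$ is strictly $\phi$-plurisubharmonic at each point of some open neighborhood of $M$ in $X$. -/

import Mathlib

open Set Filter Topology Manifold Bundle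
open scoped ContDiff

noncomputable section

namespace CalibratedGeometry

variable {E : Type*} [NormedAddCommGroup E] [NormedSpace ℝ E] [FiniteDimensional ℝ E]
  {X : Type*} [EMetricSpace X] [ChartedSpace E X]

/-- Tangent spaces are finite dimensional. -/
instance instFiniteDimensionalTangent (x : X) : FiniteDimensional ℝ (TangentSpace 𝓘(ℝ, E) x) :=
  inferInstanceAs (FiniteDimensional ℝ E)

/-! ### Differential forms -/

/-- The expression in the chart `e` of a field `φ` of alternating `p`-linear forms on the tangent
spaces of `X`, that is, the pullback of `φ` under `e⁻¹`; meaningful on `e.target`. -/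
def formInChart {p : ℕ} (φ : ∀ x : X, TangentSpace 𝓘(ℝ, E) x [⋀^Fin p]→L[ℝ] ℝ)
    (e : OpenPartialHomeomorph X E) (u : E) : E [⋀^Fin p]→L[ℝ] ℝ :=
  (φ (e.symm u)).compContinuousLinearMap
    (mfderiv 𝓘(ℝ, E) 𝓘(ℝ, E) e.symm u : E →L[ℝ] TangentSpace 𝓘(ℝ, E) (e.symm u))

/-- `φ` is a smooth (`C^∞`) differential `p`-form on `X`. -/
def IsSmoothForm {p : ℕ} (φ : ∀ x : X, TangentSpace 𝓘(ℝ, E) x [⋀^Fin p]→L[ℝ] ℝ) : Prop :=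
  ∀ e ∈ atlas E X, ContDiffOn ℝ ∞ (formInChart φ e) e.target

/-- `dφ = 0`. -/
def IsClosedForm {p : ℕ} (φ : ∀ x : X, TangentSpace 𝓘(ℝ, E) x [⋀^Fin p]→L[ℝ] ℝ) : Prop :=
  ∀ e ∈ atlas E X, ∀ u ∈ e.target, extDeriv (formInChart φ e) u = 0

variable [RiemannianBundle (fun x : X ↦ TangentSpace 𝓘(ℝ, E) x)]

/-! ### Calibrations and `φ`-planes

A unit simple `p`-vector at `x` (an oriented `p`-plane in the tangent space) is `v 0 ∧ ⋯ ∧ v (p-1)`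
for an orthonormal tuple `v`, and the value of a `p`-form on it is the value of the form on `v`.
Planes are represented by such orthonormal tuples. -/

/-- A calibration of degree `p`: a smooth closed `p`-form `φ` with `φ(ξ) ≤ 1` for all unit simple
tangent `p`-vectors `ξ`. -/
structure IsCalibration {p : ℕ} (φ : ∀ x : X, TangentSpace 𝓘(ℝ, E) x [⋀^Fin p]→L[ℝ] ℝ) :
    Prop where
  smooth : IsSmoothForm φ
  closed : IsClosedForm φ
  le_one : ∀ (x : X) (v : Fin p → TangentSpace 𝓘(ℝ, E) x), Orthonormal ℝ v → φ x v ≤ 1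

/-- The unit simple `p`-vector `ξ = v 0 ∧ ⋯ ∧ v (p-1)` is a `φ`-plane at `x`: `φ(ξ) = 1`. -/
def IsPhiPlane {p : ℕ} (φ : ∀ x : X, TangentSpace 𝓘(ℝ, E) x [⋀^Fin p]→L[ℝ] ℝ) (x : X)
    (v : Fin p → TangentSpace 𝓘(ℝ, E) x) : Prop :=
  Orthonormal ℝ v ∧ φ x v = 1

/-! ### Gradient, Levi-Civita connection, Hessian -/

/-- The Riemannian gradient: `⟨∇f, v⟩ = df(v)`. -/
def gradient (f : X → ℝ) (x : X) : TangentSpace 𝓘(ℝ, E) x :=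
  haveI := FiniteDimensional.complete ℝ (TangentSpace 𝓘(ℝ, E) x)
  (InnerProductSpace.toDual ℝ (TangentSpace 𝓘(ℝ, E) x)).symm (mvfderiv 𝓘(ℝ, E) f x)

/-- The Riemannian metric in the chart `e`: the bilinear forms
`g_u(a, b) = ⟨D(e⁻¹)_u a, D(e⁻¹)_u b⟩` on `E`, for `u ∈ e.target`. -/
def metricInChart (e : OpenPartialHomeomorph X E) (u : E) : E →L[ℝ] E →L[ℝ] ℝ :=
  (innerSL ℝ (E := TangentSpace 𝓘(ℝ, E) (e.symm u))).bilinearComp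
    (mfderiv 𝓘(ℝ, E) 𝓘(ℝ, E) e.symm u : E →L[ℝ] TangentSpace 𝓘(ℝ, E) (e.symm u))
    (mfderiv 𝓘(ℝ, E) 𝓘(ℝ, E) e.symm u : E →L[ℝ] TangentSpace 𝓘(ℝ, E) (e.symm u))

/-- The Christoffel symbols of the first kind of the metric in the chart `e`:
`Γ_u(a, b)(c) = ½ (∂_a g(b, c) + ∂_b g(a, c) - ∂_c g(a, b))`. -/
def christoffel (e : OpenPartialHomeomorph X E) (u a b : E) : E →L[ℝ] ℝ :=
  let Dg := fderiv ℝ (metricInChart e) u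
  (1 / 2 : ℝ) • (Dg a b + Dg b a - (Dg.flip a).flip b)

/-- The expression of a vector field `Y` in the chart `e`. -/
def fieldInChart (e : OpenPartialHomeomorph X E) (Y : ∀ x : X, TangentSpace 𝓘(ℝ, E) x)
    (u : E) : E :=
  mfderiv 𝓘(ℝ, E) 𝓘(ℝ, E) e (e.symm u) (Y (e.symm u))

/-- The Levi-Civita (Riemannian) connection `∇_v Y` at `x`, computed in the chart `e` at `x`: in
coordinates `(∇_v Y)^k = ∂_v Y^k + Γ^k_{ij} v^i Y^j`, where `Γ^k_{ij}` is obtained from the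
Christoffel symbols of the first kind by raising the last index with the metric. -/
def leviCivita (Y : ∀ x : X, TangentSpace 𝓘(ℝ, E) x) (x : X) (v : TangentSpace 𝓘(ℝ, E) x) :
    TangentSpace 𝓘(ℝ, E) x :=
  haveI := FiniteDimensional.complete ℝ (TangentSpace 𝓘(ℝ, E) x)
  let e : OpenPartialHomeomorph X E := chartAt E x
  let D : TangentSpace 𝓘(ℝ, E) x →L[ℝ] E := mfderiv 𝓘(ℝ, E) 𝓘(ℝ, E) e x
  D.inverse (fderiv ℝ (fieldInChart e Y) (e x) (D v)) +
    (InnerProductSpace.toDual ℝ (TangentSpace 𝓘(ℝ, E) x)).symm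
      ((christoffel e (e x) (D v) (D (Y x))).comp D)

/-- The Riemannian Hessian of `f` at `x`, as the endomorphism `v ↦ ∇_v (∇f)` of the tangent
space. -/
def hessian (f : X → ℝ) (x : X) (v : TangentSpace 𝓘(ℝ, E) x) : TangentSpace 𝓘(ℝ, E) x :=
  leviCivita (gradient f) x v

/-! ### The `φ`-Hessian and plurisubharmonicity -/

/-- `λ_φ(A) = D_{A^t} φ`, the action of an endomorphism `A` on an alternating form `φ` as a
derivation: `λ_φ(A)(v₁, …, v_p) = ∑ i, φ(v₁, …, A v_i, …, v_p)`. -/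
def derivationAction {V : Type*} [AddCommGroup V] [Module ℝ V] [TopologicalSpace V] {p : ℕ}
    (φ : V [⋀^Fin p]→L[ℝ] ℝ) (A : V → V) (v : Fin p → V) : ℝ :=
  ∑ i, φ (Function.update v i (A (v i)))

/-- The `φ`-Hessian `λ_φ(Hess f)` at `x`. -/
def phiHessian {p : ℕ} (φ : ∀ x : X, TangentSpace 𝓘(ℝ, E) x [⋀^Fin p]→L[ℝ] ℝ) (f : X → ℝ)
    (x : X) (v : Fin p → TangentSpace 𝓘(ℝ, E) x) : ℝ :=
  derivationAction (φ x) (hessian f x) v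

/-- `f` is strictly `φ`-plurisubharmonic at `x`: `f` is smooth on a neighbourhood of `x` and its
`φ`-Hessian is positive on all `φ`-planes at `x`. -/
def StrictlyPSHAt {p : ℕ} (φ : ∀ x : X, TangentSpace 𝓘(ℝ, E) x [⋀^Fin p]→L[ℝ] ℝ) (f : X → ℝ)
    (x : X) : Prop :=
  (∀ᶠ y in 𝓝 x, ContMDiffAt 𝓘(ℝ, E) 𝓘(ℝ, ℝ) ∞ f y) ∧
    ∀ v : Fin p → TangentSpace 𝓘(ℝ, E) x, IsPhiPlane φ x v → 0 < phiHessian φ f x v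

/-! ### Submanifolds -/

/-- Half the squared Riemannian distance to the set `S`. -/
def halfSqDist (S : Set X) (x : X) : ℝ := (1 / 2) * (Metric.infEDist x S).toReal ^ 2

variable {F : Type*} [NormedAddCommGroup F] [NormedSpace ℝ F]
  {M : Type*} [TopologicalSpace M] [ChartedSpace F M]

/-- The tangent space at `ι m` of the submanifold parametrized by the embedding `ι : M → X`, as a
subspace of the tangent space of `X`. -/
def tangentOf (ι : M → X) (m : M) : Submodule ℝ (TangentSpace 𝓘(ℝ, E) (ι m)) :=
  (mfderiv 𝓘(ℝ, F) 𝓘(ℝ, E) ι m).range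

/-- The submanifold parametrized by `ι` is `φ`-free: no `φ`-plane is tangential to it. -/
def IsPhiFree {p : ℕ} (φ : ∀ x : X, TangentSpace 𝓘(ℝ, E) x [⋀^Fin p]→L[ℝ] ℝ) (ι : M → X) :
    Prop :=
  ∀ (m : M) (v : Fin p → TangentSpace 𝓘(ℝ, E) (ι m)), IsPhiPlane φ (ι m) v →
    ¬ Submodule.span ℝ (range v) ≤ tangentOf (F := F) ι m

end CalibratedGeometry

end

open CalibratedGeometry

/-!
Near a point `x₀` of `M` choose a chart in which `M` is a linear slice. A conormal covector at a
point of the slice is the initial momentum of a geodesic normal to `M`, and the endpoint of this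
geodesic at time one defines a diffeomorphism of a neighbourhood of `(x₀, 0)` in the conormal bundle
onto a neighbourhood of `x₀`. Let `f` be the kinetic energy of the momentum whose geodesic ends at the
given point. As the canonical one-form vanishes on the conormal bundle, the first variation formula
(`exists_cogeodesic_flow`) says that `Df` is the final momentum, which is the Gauss lemma; hence
`|∇f|² = 2f` (`exists_eikonal`). Thus `√(2f)` is `1`-Lipschitz, and it is the length of a geodesic
from `M`, so that `f` is half the squared distance to `M` (`exists_halfSqDist_eq`). This gives the
smoothness. Differentiating `Df` = final momentum at the zero section shows that the second
derivative of `f` at `x₀` is the metric on the normal space extended by zero to the tangent space of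
`M`; since `x₀` is a critical point this is the Hessian, that is, `Hess f = P_N`.

The cogeodesic flow has to be smooth in the initial condition up to time one. The zero covector
is a zero of the Hamiltonian field with nilpotent linearization, and there the flow is obtained from
the inverse function theorem applied to the integral equation in the space of continuous paths
(`exists_smooth_flow`).

For the `φ`-Hessian, the first cousin principle (`apply_update_eq_zero_of_orthogonal`) says that at
a `φ`-plane `v` the form `φ` does not change to first order if one vector is rotated towards a normal
direction. Hence `λ_φ(A)(v)` is the trace of `A` on the plane, and for `A = P_N` it is
`∑ ‖P_N v_i‖²`, which vanishes exactly if the plane is tangent to `M`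
(`IsCalibration.phiHessian_pos_iff`). Finally strict plurisubharmonicity is an open condition, by
continuity and compactness of the set of `φ`-planes (`StrictlyPSHAt.eventually`).
-/

namespace CalibratedGeometry

/-! ### The superposition operator -/

section Superposition

set_option maxSynthPendingDepth 5

universe u

variable {K : Type*} [TopologicalSpace K] [CompactSpace K]
  {Z Y : Type*} [NormedAddCommGroup Z] [NormedSpace ℝ Z] [NormedAddCommGroup Y] [NormedSpace ℝ Y]

/-- The pointwise application of a bounded bilinear map to a pair of continuous functions, as a
bounded bilinear map. -/
noncomputable def pointwiseBilin (K : Type*) [TopologicalSpace K] [CompactSpace K]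
    {A B Y : Type*} [NormedAddCommGroup A] [NormedSpace ℝ A]
    [NormedAddCommGroup B] [NormedSpace ℝ B] [NormedAddCommGroup Y] [NormedSpace ℝ Y]
    (L : A →L[ℝ] B →L[ℝ] Y) : C(K, A) →L[ℝ] C(K, B) →L[ℝ] C(K, Y) :=
  LinearMap.mkContinuous₂
    (LinearMap.mk₂ ℝ
      (fun (a : C(K, A)) (h : C(K, B)) ↦
        (⟨fun t ↦ L (a t) (h t), (L.continuous.comp a.continuous).clm_apply h.continuous⟩ :
          C(K, Y)))
      (fun a a' h ↦ by ext t; simp) (fun c a h ↦ by ext t; simp)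
      (fun a h h' ↦ by ext t; simp) (fun c a h ↦ by ext t; simp)) ‖L‖
    (fun a h ↦ by
      refine (ContinuousMap.norm_le _ (by positivity)).2 fun t ↦ ?_
      refine (L.le_opNorm₂ (a t) (h t)).trans ?_
      gcongr
      exacts [a.norm_coe_le_norm t, h.norm_coe_le_norm t])

@[simp]
lemma pointwiseBilin_apply {A B Y : Type*} [NormedAddCommGroup A] [NormedSpace ℝ A]
    [NormedAddCommGroup B] [NormedSpace ℝ B] [NormedAddCommGroup Y] [NormedSpace ℝ Y]
    (L : A →L[ℝ] B →L[ℝ] Y) (a : C(K, A)) (h : C(K, B)) (t : K) :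
    pointwiseBilin K L a h t = L (a t) (h t) := rfl

/-- The pointwise application of a continuous family of operators to a continuous family of
vectors, as a bounded bilinear map. -/
noncomputable abbrev pointwiseApply (K Z Y : Type*) [TopologicalSpace K] [CompactSpace K]
    [NormedAddCommGroup Z] [NormedSpace ℝ Z] [NormedAddCommGroup Y] [NormedSpace ℝ Y] :
    C(K, Z →L[ℝ] Y) →L[ℝ] C(K, Z) →L[ℝ] C(K, Y) :=
  pointwiseBilin K (ContinuousLinearMap.id ℝ (Z →L[ℝ] Y))

/-- The derivative of the superposition operator `γ ↦ f ∘ γ` is `h ↦ (Df ∘ γ) · h`. -/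
lemma hasFDerivAt_postcomp (f : C(Z, Y)) (f' : C(Z, Z →L[ℝ] Y))
    (hf : ∀ z, HasFDerivAt f (f' z) z) (γ : C(K, Z)) :
    HasFDerivAt (fun γ : C(K, Z) ↦ f.comp γ) (pointwiseApply K Z Y (f'.comp γ)) γ := by
  rw [hasFDerivAt_iff_isLittleO, Asymptotics.isLittleO_iff]
  intro ε hε
  have hc : ContinuousAt (fun γ : C(K, Z) ↦ f'.comp γ) γ :=
    (ContinuousMap.continuous_postcomp f').continuousAt
  obtain ⟨δ, hδ, H⟩ :=
    (Metric.continuousAt_iff (α := C(K, Z)) (β := C(K, Z →L[ℝ] Y))).1 hc ε hε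
  -- uniformity in `t` comes from testing continuity of `γ ↦ Df ∘ γ` on translates of `γ`
  have key : ∀ t z, z ∈ Metric.ball (γ t) δ → ‖f' z - f' (γ t)‖ ≤ ε := by
    intro t z hz
    have h1 : dist (γ + ContinuousMap.const K (z - γ t)) γ < δ := by
      rw [dist_eq_norm, add_sub_cancel_left]
      refine (ContinuousMap.norm_lt_iff _ hδ).2 fun s ↦ ?_
      simpa [dist_eq_norm] using hz
    have h2 := H h1
    have h3 := (ContinuousMap.dist_apply_le_dist
      (f := f'.comp (γ + ContinuousMap.const K (z - γ t)))
      (g := f'.comp γ) t).trans h2.le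
    rw [dist_eq_norm] at h3
    simpa using h3
  filter_upwards [Metric.ball_mem_nhds γ hδ] with η hη
  refine (ContinuousMap.norm_le _ (by positivity)).2 fun t ↦ ?_
  have hηt : η t ∈ Metric.ball (γ t) δ :=
    lt_of_le_of_lt (ContinuousMap.dist_apply_le_dist t) hη
  have := (convex_ball (γ t) δ).norm_image_sub_le_of_norm_hasFDerivWithin_le'
    (f := f) (f' := f') (φ := f' (γ t)) (C := ε)
    (fun z _ ↦ (hf z).hasFDerivWithinAt) (fun z hz ↦ key t z hz)
    (Metric.mem_ball_self hδ) hηt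
  refine (le_trans (le_of_eq ?_) this).trans ?_
  · simp
  · exact mul_le_mul_of_nonneg_left ((η - γ).norm_coe_le_norm t) hε.le

/-- The induction on `n` passes from `Y` to `Z →L[ℝ] Y`, so both live in the same universe. -/
lemma contDiff_postcomp_nat {Z : Type u} [NormedAddCommGroup Z] [NormedSpace ℝ Z] (n : ℕ) :
    ∀ {Y : Type u} [NormedAddCommGroup Y] [NormedSpace ℝ Y] (f : C(Z, Y)), ContDiff ℝ n f →
      ContDiff ℝ n (fun γ : C(K, Z) ↦ f.comp γ) := by
  induction n with
  | zero =>
    intro Y _ _ f _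
    exact contDiff_zero.2 (ContinuousMap.continuous_postcomp f)
  | succ n ih =>
    intro Y _ _ f hf
    have hf' : ContDiff ℝ (n + 1) f := by exact_mod_cast hf
    obtain ⟨hd, -, hfd⟩ := contDiff_succ_iff_fderiv.1 hf'
    let f' : C(Z, Z →L[ℝ] Y) := ⟨fderiv ℝ f, hfd.continuous⟩
    have hder := fun γ : C(K, Z) ↦ hasFDerivAt_postcomp f f' (fun z ↦ (hd z).hasFDerivAt) γ
    have : ContDiff ℝ (n + 1) (fun γ : C(K, Z) ↦ f.comp γ) := by
      refine contDiff_succ_iff_fderiv.2 ⟨fun γ ↦ (hder γ).differentiableAt, by simp, ?_⟩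
      have : fderiv ℝ (fun γ : C(K, Z) ↦ f.comp γ) =
          fun γ ↦ pointwiseApply K Z Y (f'.comp γ) := funext fun γ ↦ (hder γ).fderiv
      rw [this]
      exact (pointwiseApply K Z Y).contDiff.comp (ih f' hfd)
    exact_mod_cast this

/-- The superposition operator of a smooth map is smooth. -/
lemma contDiff_postcomp {Z Y : Type u} [NormedAddCommGroup Z] [NormedSpace ℝ Z]
    [NormedAddCommGroup Y] [NormedSpace ℝ Y] (f : C(Z, Y)) (hf : ContDiff ℝ ∞ f) :
    ContDiff ℝ ∞ (fun γ : C(K, Z) ↦ f.comp γ) :=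
  contDiff_infty.2 fun n ↦ contDiff_postcomp_nat n f (contDiff_infty.1 hf n)

end Superposition

/-! ### The primitive of a continuous path -/

section Primitive

variable {Z : Type*} [NormedAddCommGroup Z]

/-- The constant extension of a path on `[0, 1]` to the real line. -/
noncomputable def extendPath (h : C(unitInterval, Z)) (s : ℝ) : Z :=
  h (projIcc 0 1 zero_le_one s)

lemma continuous_extendPath (h : C(unitInterval, Z)) : Continuous (extendPath h) :=
  h.continuous.comp continuous_projIcc

variable [NormedSpace ℝ Z] [CompleteSpace Z]

lemma hasDerivAt_primitive (h : C(unitInterval, Z)) (t : ℝ) :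
    HasDerivAt (fun t ↦ ∫ s in (0 : ℝ)..t, extendPath h s) (extendPath h t) t :=
  intervalIntegral.integral_hasDerivAt_right
    ((continuous_extendPath h).intervalIntegrable _ _)
    ((continuous_extendPath h).stronglyMeasurableAtFilter _ _)
    (continuous_extendPath h).continuousAt

/-- The operator sending a path on `[0, 1]` to its primitive vanishing at `0`. -/
noncomputable def primitiveCLM (Z : Type*) [NormedAddCommGroup Z] [NormedSpace ℝ Z]
    [CompleteSpace Z] : C(unitInterval, Z) →L[ℝ] C(unitInterval, Z) :=
  LinearMap.mkContinuous
    { toFun := fun h ↦ ⟨fun t ↦ ∫ s in (0 : ℝ)..t, extendPath h s,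
        (continuous_iff_continuousAt.2 fun t ↦ (hasDerivAt_primitive h t).continuousAt).comp
          continuous_subtype_val⟩
      map_add' := fun h k ↦ by
        ext t
        exact intervalIntegral.integral_add ((continuous_extendPath h).intervalIntegrable _ _)
          ((continuous_extendPath k).intervalIntegrable _ _)
      map_smul' := fun c h ↦ by
        ext t
        exact intervalIntegral.integral_smul c _ } 1
    (fun h ↦ by
      rw [one_mul]
      refine (ContinuousMap.norm_le _ (norm_nonneg _)).2 fun t ↦ ?_
      refine (intervalIntegral.norm_integral_le_of_norm_le_const
        (C := ‖h‖) fun s _ ↦ h.norm_coe_le_norm _).trans ?_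
      rw [sub_zero, abs_of_nonneg t.2.1]
      exact mul_le_of_le_one_right (norm_nonneg _) t.2.2)

lemma primitiveCLM_apply (h : C(unitInterval, Z)) (t : unitInterval) :
    primitiveCLM Z h t = ∫ s in (0 : ℝ)..t, extendPath h s := rfl

lemma primitiveCLM_const (c : Z) (t : unitInterval) :
    primitiveCLM Z (ContinuousMap.const _ c) t = (t : ℝ) • c := by
  rw [primitiveCLM_apply]
  simp [extendPath]

end Primitive

/-! ### Smooth local inverses -/

section Inverse

variable {V Y : Type*} [NormedAddCommGroup V] [NormedSpace ℝ V]
  [NormedAddCommGroup Y] [NormedSpace ℝ Y]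

/-- The inverse function theorem with a smooth inverse on a whole neighbourhood (and not only of
each finite order on a neighbourhood depending on the order). -/
lemma exists_smooth_localInverse [CompleteSpace V] {f : V → Y} {U : Set V} (hU : IsOpen U)
    (hf : ContDiffOn ℝ ∞ f U) {a : V} (ha : a ∈ U) (f' : V ≃L[ℝ] Y)
    (hf' : HasFDerivAt f (f' : V →L[ℝ] Y) a) :
    ∃ Φ : OpenPartialHomeomorph V Y, (Φ : V → Y) = f ∧ a ∈ Φ.source ∧ Φ.source ⊆ U ∧
      (∀ x ∈ Φ.source, (fderiv ℝ f x).IsInvertible) ∧ ContDiffOn ℝ ∞ Φ.symm Φ.target := by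
  have hfa : ContDiffAt ℝ ∞ f a := hf.contDiffAt (hU.mem_nhds ha)
  let Φ₀ := hfa.toOpenPartialHomeomorph f hf' (by simp)
  have hcont : ContinuousOn (fderiv ℝ f) U := hf.continuousOn_fderiv_of_isOpen hU (by simp)
  let O : Set V := U ∩ fderiv ℝ f ⁻¹' range ((↑) : (V ≃L[ℝ] Y) → V →L[ℝ] Y)
  have hO : IsOpen O := hcont.isOpen_inter_preimage hU ContinuousLinearEquiv.isOpen
  have haO : a ∈ O := ⟨ha, f', hf'.fderiv.symm⟩
  refine ⟨Φ₀.restrOpen O hO, rfl, ⟨?_, haO⟩, fun x hx ↦ hx.2.1, fun x hx ↦ ?_, ?_⟩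
  · exact hfa.mem_toOpenPartialHomeomorph_source hf' (by simp)
  · obtain ⟨e, he⟩ := hx.2.2
    exact ⟨e, he⟩
  · intro y hy
    have hx := (Φ₀.restrOpen O hO).map_target hy
    obtain ⟨e, he⟩ := hx.2.2
    have hd : ContDiffAt ℝ ∞ f ((Φ₀.restrOpen O hO).symm y) :=
      hf.contDiffAt (hU.mem_nhds hx.2.1)
    refine ((Φ₀.restrOpen O hO).contDiffAt_symm (f₀' := e) hy ?_ hd).contDiffWithinAt
    rw [he]
    exact (hd.differentiableAt (by simp)).hasFDerivAt

/-- A function which is smooth on a neighbourhood of a point coincides near this point with a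
globally smooth function. -/
lemma exists_contDiff_eqOn_ball [FiniteDimensional ℝ V] {f : V → Y} {U : Set V} (hU : IsOpen U)
    (hf : ContDiffOn ℝ ∞ f U) {a : V} (ha : a ∈ U) :
    ∃ g : V → Y, ContDiff ℝ ∞ g ∧ ∃ r > 0, Metric.ball a r ⊆ U ∧ EqOn g f (Metric.ball a r) := by
  obtain ⟨R, hR, hRU⟩ := Metric.isOpen_iff.1 hU a ha
  let χ : ContDiffBump a := ⟨R / 4, R / 2, by positivity, by linarith⟩
  refine ⟨fun x ↦ χ x • f x, contDiff_iff_contDiffAt.2 fun x ↦ ?_, R / 4, by positivity,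
    (Metric.ball_subset_ball (by linarith)).trans hRU, fun x hx ↦ ?_⟩
  · by_cases hx : x ∈ U
    · exact χ.contDiffAt.smul (hf.contDiffAt (hU.mem_nhds hx))
    · have : x ∉ tsupport χ := by
        rw [χ.tsupport_eq]
        intro h
        exact hx (hRU (Metric.closedBall_subset_ball (by change R / 2 < R; linarith) h))
      refine contDiffAt_const (c := (0 : Y)) |>.congr_of_eventuallyEq ?_
      filter_upwards [(isClosed_tsupport χ).isOpen_compl.mem_nhds this] with y hy
      rw [image_eq_zero_of_notMem_tsupport hy, zero_smul]
  · simp only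
    rw [χ.one_of_mem_closedBall (Metric.ball_subset_closedBall hx), one_smul]

end Inverse

/-! ### The flow of a vector field near a nilpotent zero -/

section Flow

universe u

variable {Z : Type u} [NormedAddCommGroup Z] [NormedSpace ℝ Z] [CompleteSpace Z]

lemma hasDerivWithinAt_projIcc_of_eq_primitive {γ κ : C(unitInterval, Z)} {z : Z}
    (h : γ = ContinuousMap.const _ z + primitiveCLM Z κ) (t : ℝ) (ht : t ∈ Icc (0 : ℝ) 1) :
    HasDerivWithinAt (extendPath γ) (extendPath κ t) (Icc 0 1) t := by
  refine ((hasDerivAt_primitive κ t).const_add z).hasDerivWithinAt.congr_of_mem (fun s hs ↦ ?_) ht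
  rw [extendPath, h, projIcc_of_mem zero_le_one hs]
  rfl

lemma contDiffOn_extendPath_of_eq_primitive {γ κ : C(unitInterval, Z)} {z : Z}
    (h : γ = ContinuousMap.const _ z + primitiveCLM Z κ) :
    ContDiffOn ℝ 1 (extendPath γ) (Icc 0 1) := by
  have h1 : ContDiff ℝ 1 (fun t ↦ z + ∫ s in (0 : ℝ)..t, extendPath κ s) := by
    rw [contDiff_one_iff_deriv]
    have hd := fun t ↦ (hasDerivAt_primitive κ t).const_add z
    refine ⟨fun t ↦ (hd t).differentiableAt, ?_⟩
    rw [show deriv (fun t ↦ z + ∫ s in (0 : ℝ)..t, extendPath κ s) = extendPath κ from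
      funext fun t ↦ (hd t).deriv]
    exact continuous_extendPath κ
  refine h1.contDiffOn.congr fun s hs ↦ ?_
  rw [extendPath, h, projIcc_of_mem zero_le_one hs]
  rfl

/-- The time-one flow of a smooth vector field `X` near a zero `z₀` at which the square of the
linearization vanishes. The integral equation `γ - ∫ X ∘ γ = z` is solved for the path `γ` by the
inverse function theorem in the space of continuous paths: its linearization at the constant path
`z₀` is `1 - K` with `K² = 0`, so that it has the inverse `1 + K` and no smallness of the time is
needed. The last two conclusions are the variational equation and its solution at `z₀`. -/
theorem exists_smooth_flow {X : Z → Z} (hX : ContDiff ℝ ∞ X) {z₀ : Z} (h₀ : X z₀ = 0)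
    (hN : ∀ h, fderiv ℝ X z₀ (fderiv ℝ X z₀ h) = 0) {ρ : ℝ} (hρ : 0 < ρ) :
    ∃ r > 0, ∃ Γ : Z → ℝ → Z,
      (∀ t, ContDiffOn ℝ ∞ (fun z ↦ Γ z t) (Metric.ball z₀ r)) ∧
      (∀ z ∈ Metric.ball z₀ r, Γ z 0 = z ∧ ContDiffOn ℝ 1 (Γ z) (Icc 0 1) ∧
        ∀ t ∈ Icc (0 : ℝ) 1, Γ z t ∈ Metric.ball z₀ ρ ∧
          HasDerivWithinAt (Γ z) (X (Γ z t)) (Icc 0 1) t ∧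
          ∀ h, HasDerivWithinAt (fun t ↦ fderiv ℝ (fun z ↦ Γ z t) z h)
            (fderiv ℝ X (Γ z t) (fderiv ℝ (fun z ↦ Γ z t) z h)) (Icc 0 1) t) ∧
      Γ z₀ 1 = z₀ ∧ ∀ h, fderiv ℝ (fun z ↦ Γ z 1) z₀ h = h + fderiv ℝ X z₀ h := by
  let Xc : C(Z, Z) := ⟨X, hX.continuous⟩
  have hX' : Continuous (fderiv ℝ X) := hX.continuous_fderiv (by simp)
  let X' : C(Z, Z →L[ℝ] Z) := ⟨fderiv ℝ X, hX'⟩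
  have hd : ∀ z, HasFDerivAt X (X' z) z := fun z ↦ (hX.differentiable (by simp) z).hasFDerivAt
  let c : Z →L[ℝ] C(unitInterval, Z) := ContinuousLinearMap.const ℝ unitInterval
  let Ψ : C(unitInterval, Z) → C(unitInterval, Z) := fun γ ↦ γ - primitiveCLM Z (Xc.comp γ)
  have hΨ : ContDiff ℝ ∞ Ψ :=
    contDiff_id.sub ((primitiveCLM Z).contDiff.comp (contDiff_postcomp Xc hX))
  have hΨ' : ∀ γ, HasFDerivAt Ψ (ContinuousLinearMap.id ℝ _ -
      (primitiveCLM Z).comp (pointwiseApply unitInterval Z Z (X'.comp γ))) γ := fun γ ↦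
    (hasFDerivAt_id γ).sub ((primitiveCLM Z).hasFDerivAt.comp γ (hasFDerivAt_postcomp Xc X' hd γ))
  -- the linearization at the constant path
  let N : Z →L[ℝ] Z := fderiv ℝ X z₀
  let K : C(unitInterval, Z) →L[ℝ] C(unitInterval, Z) :=
    (primitiveCLM Z).comp (pointwiseApply unitInterval Z Z (X'.comp (c z₀)))
  have hKapp : ∀ h : C(unitInterval, Z),
      K h = primitiveCLM Z ((⟨N, N.continuous⟩ : C(Z, Z)).comp h) :=
    fun h ↦ rfl
  have hKK : ∀ h, K (K h) = 0 := by
    intro h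
    have : (⟨N, N.continuous⟩ : C(Z, Z)).comp (K h) = 0 := by
      ext t
      change N (∫ s in (0 : ℝ)..t, extendPath ((⟨N, N.continuous⟩ : C(Z, Z)).comp h) s) = 0
      rw [← N.intervalIntegral_comp_comm ((continuous_extendPath _).intervalIntegrable _ _)]
      refine (intervalIntegral.integral_congr (g := fun _ ↦ (0 : Z)) fun s _ ↦ ?_).trans (by simp)
      exact hN _
    rw [hKapp, this, map_zero]
  let e : C(unitInterval, Z) ≃L[ℝ] C(unitInterval, Z) :=
    ContinuousLinearEquiv.equivOfInverse (ContinuousLinearMap.id ℝ _ - K)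
      (ContinuousLinearMap.id ℝ _ + K)
      (fun h ↦ by simp [hKK]) (fun h ↦ by simp [hKK])
  obtain ⟨Φ, hΦ, hmem, -, -, hsymm⟩ := exists_smooth_localInverse isOpen_univ hΨ.contDiffOn
    (mem_univ (c z₀)) e (hΨ' (c z₀))
  have hΨ₀ : Ψ (c z₀) = c z₀ := by
    have : Xc.comp (c z₀) = 0 := by
      ext t
      exact h₀
    simp only [Ψ, this, map_zero, sub_zero]
  have ht₀ : c z₀ ∈ Φ.target := by
    have := Φ.map_source hmem
    rwa [hΦ, hΨ₀] at this
  have hs₀ : Φ.symm (c z₀) = c z₀ := by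
    have := Φ.left_inv hmem
    rwa [hΦ, hΨ₀] at this
  -- the domain of the flow
  have hO : Φ.symm ⁻¹' (Metric.ball (c z₀) ρ) ∩ Φ.target ∈ 𝓝 (c z₀) := by
    refine inter_mem ?_ (Φ.open_target.mem_nhds ht₀)
    refine (Φ.continuousAt_symm ht₀).preimage_mem_nhds ?_
    rw [hs₀]
    exact Metric.ball_mem_nhds _ hρ
  obtain ⟨r, hr, hball⟩ := Metric.mem_nhds_iff.1 (c.continuous.continuousAt.preimage_mem_nhds hO)
  let Γ : Z → C(unitInterval, Z) := fun z ↦ Φ.symm (c z)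
  have hΓ : ContDiffOn ℝ ∞ Γ (Metric.ball z₀ r) :=
    hsymm.comp c.contDiff.contDiffOn fun z hz ↦ (hball hz).2
  have hΓeq : ∀ z ∈ Metric.ball z₀ r,
      Γ z = ContinuousMap.const _ z + primitiveCLM Z (Xc.comp (Γ z)) := by
    intro z hz
    have := Φ.right_inv (hball hz).2
    rw [hΦ] at this
    exact (sub_eq_iff_eq_add.1 this)
  have hΓd : ∀ z ∈ Metric.ball z₀ r, HasFDerivAt Γ (fderiv ℝ Γ z) z := fun z hz ↦
    ((hΓ.contDiffAt (Metric.isOpen_ball.mem_nhds hz)).differentiableAt (by simp)).hasFDerivAt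
  have hvar : ∀ z ∈ Metric.ball z₀ r, ∀ h, fderiv ℝ Γ z h = ContinuousMap.const _ h +
      primitiveCLM Z (pointwiseApply unitInterval Z Z (X'.comp (Γ z)) (fderiv ℝ Γ z h)) := by
    intro z hz h
    have h1 : HasFDerivAt (fun z ↦ Ψ (Γ z)) _ z := (hΨ' (Γ z)).comp z (hΓd z hz)
    have h2 : HasFDerivAt (fun z ↦ Ψ (Γ z)) c z := by
      refine c.hasFDerivAt.congr_of_eventuallyEq ?_
      filter_upwards [Metric.isOpen_ball.mem_nhds hz] with y hy
      have := Φ.right_inv (hball hy).2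
      rwa [hΦ] at this
    have h3 := DFunLike.congr_fun (h1.unique h2) h
    exact sub_eq_iff_eq_add.1 h3
  -- evaluation at a time
  let ev : ℝ → C(unitInterval, Z) →L[ℝ] Z := fun t ↦
    ContinuousMap.evalCLM ℝ (projIcc 0 1 zero_le_one t)
  have hevd : ∀ t, ∀ z ∈ Metric.ball z₀ r, ∀ h,
      fderiv ℝ (fun z ↦ extendPath (Γ z) t) z h = extendPath (fderiv ℝ Γ z h) t := by
    intro t z hz h
    exact DFunLike.congr_fun ((ev t).hasFDerivAt.comp z (hΓd z hz)).fderiv h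
  have hz₀ : z₀ ∈ Metric.ball z₀ r := Metric.mem_ball_self hr
  refine ⟨r, hr, fun z ↦ extendPath (Γ z), fun t ↦ (ev t).contDiff.comp_contDiffOn hΓ,
    fun z hz ↦ ⟨?_, contDiffOn_extendPath_of_eq_primitive (hΓeq z hz), fun t ht ↦
      ⟨?_, hasDerivWithinAt_projIcc_of_eq_primitive (hΓeq z hz) t ht, fun h ↦ ?_⟩⟩, ?_, fun h ↦ ?_⟩
  · change extendPath (Γ z) 0 = z
    rw [hΓeq z hz, extendPath, projIcc_left]
    simp [primitiveCLM_apply]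
  · exact lt_of_le_of_lt (ContinuousMap.dist_apply_le_dist (f := Γ z) (g := c z₀) _) (hball hz).1
  · simp_rw [hevd _ z hz]
    exact hasDerivWithinAt_projIcc_of_eq_primitive (hvar z hz h) t ht
  · change extendPath (Φ.symm (c z₀)) 1 = z₀
    rw [hs₀]
    rfl
  · rw [hevd _ z₀ hz₀]
    have h1 : fderiv ℝ Γ z₀ h = c h + K (c h) := by
      have h2 : fderiv ℝ Γ z₀ h = c h + K (fderiv ℝ Γ z₀ h) := by
        have := hvar z₀ hz₀ h
        rwa [show Γ z₀ = c z₀ from hs₀] at this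
      have h3 : K (fderiv ℝ Γ z₀ h) = K (c h) := by
        rw [h2, map_add, hKK, add_zero]
      rw [h2, h3]
    have h4 : (⟨N, N.continuous⟩ : C(Z, Z)).comp (c h) = ContinuousMap.const _ (N h) := rfl
    rw [h1, hKapp, h4, extendPath, projIcc_right, ContinuousMap.add_apply, primitiveCLM_const]
    simp only [one_smul]
    rfl

end Flow

/-! ### The cogeodesic flow -/

section Hamiltonian

set_option maxSynthPendingDepth 5

universe u

variable {V : Type u} [NormedAddCommGroup V] [NormedSpace ℝ V]

/-- The kinetic energy `½ ⟨p, p⟩` of a covector `p` at `q`, where the dual metric is given as a map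
`B q` from covectors to vectors. -/
noncomputable def hamiltonian (B : V → (V →L[ℝ] ℝ) →L[ℝ] V) (z : V × (V →L[ℝ] ℝ)) : ℝ :=
  (1 / 2) * z.2 (B z.1 z.2)

/-- The Hamiltonian vector field of the kinetic energy; its flow is the cogeodesic flow. -/
noncomputable def hamiltonianField (B : V → (V →L[ℝ] ℝ) →L[ℝ] V) (z : V × (V →L[ℝ] ℝ)) :
    V × (V →L[ℝ] ℝ) :=
  (B z.1 z.2, -((1 / 2 : ℝ) • z.2.comp ((fderiv ℝ B z.1).flip z.2)))

lemma hasFDerivAt_velocity {B : V → (V →L[ℝ] ℝ) →L[ℝ] V} {z : V × (V →L[ℝ] ℝ)}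
    (hB : DifferentiableAt ℝ B z.1) :
    HasFDerivAt (fun z : V × (V →L[ℝ] ℝ) ↦ B z.1 z.2)
      ((B z.1).comp (ContinuousLinearMap.snd ℝ V (V →L[ℝ] ℝ)) +
        ((fderiv ℝ B z.1).comp (ContinuousLinearMap.fst ℝ V (V →L[ℝ] ℝ))).flip z.2) z :=
  (hB.hasFDerivAt.comp z hasFDerivAt_fst).clm_apply hasFDerivAt_snd

lemma fderiv_hamiltonian {B : V → (V →L[ℝ] ℝ) →L[ℝ] V} {z : V × (V →L[ℝ] ℝ)}
    (hB : DifferentiableAt ℝ B z.1) (hs : ∀ p p' : V →L[ℝ] ℝ, p (B z.1 p') = p' (B z.1 p))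
    (a : V) (b : V →L[ℝ] ℝ) :
    DifferentiableAt ℝ (hamiltonian B) z ∧
    fderiv ℝ (hamiltonian B) z (a, b) =
      (1 / 2) * z.2 (fderiv ℝ B z.1 a z.2) + z.2 (B z.1 b) := by
  have h := ((hasFDerivAt_snd (𝕜 := ℝ) (p := z)).clm_apply
    (hasFDerivAt_velocity hB)).const_mul (1 / 2 : ℝ)
  have h' : HasFDerivAt (hamiltonian B) _ z := h
  refine ⟨h'.differentiableAt, ?_⟩
  rw [h'.fderiv]
  simp [hs b z.2]
  ring

lemma contDiffOn_hamiltonian {B : V → (V →L[ℝ] ℝ) →L[ℝ] V} {W : Set V}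
    (hB : ContDiffOn ℝ ∞ B W) :
    ContDiffOn ℝ ∞ (hamiltonian B) (W ×ˢ univ) := by
  have h1 : ContDiffOn ℝ ∞ (fun z : V × (V →L[ℝ] ℝ) ↦ B z.1) (W ×ˢ univ) :=
    hB.comp contDiffOn_fst fun z hz ↦ hz.1
  exact contDiffOn_const.mul (contDiffOn_snd.clm_apply (h1.clm_apply contDiffOn_snd))

lemma contDiffOn_fderiv_flip_apply {B : V → (V →L[ℝ] ℝ) →L[ℝ] V} {W : Set V} (hW : IsOpen W)
    (hB : ContDiffOn ℝ ∞ B W) :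
    ContDiffOn ℝ ∞ (fun z : V × (V →L[ℝ] ℝ) ↦ (fderiv ℝ B z.1).flip z.2) (W ×ˢ univ) := by
  have h2 : ContDiffOn ℝ ∞ (fun z : V × (V →L[ℝ] ℝ) ↦ fderiv ℝ B z.1) (W ×ˢ univ) :=
    (hB.fderiv_of_isOpen hW (by simp)).comp contDiffOn_fst fun z hz ↦ hz.1
  have h3 : ContDiffOn ℝ ∞ (fun z : V × (V →L[ℝ] ℝ) ↦ (fderiv ℝ B z.1).flip) (W ×ˢ univ) :=
    (ContinuousLinearMap.flipₗᵢ ℝ V (V →L[ℝ] ℝ) V).contDiff.comp_contDiffOn h2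
  exact h3.clm_apply contDiffOn_snd

lemma contDiffOn_hamiltonianField {B : V → (V →L[ℝ] ℝ) →L[ℝ] V} {W : Set V} (hW : IsOpen W)
    (hB : ContDiffOn ℝ ∞ B W) :
    ContDiffOn ℝ ∞ (hamiltonianField B) (W ×ˢ univ) := by
  have h1 : ContDiffOn ℝ ∞ (fun z : V × (V →L[ℝ] ℝ) ↦ B z.1) (W ×ˢ univ) :=
    hB.comp contDiffOn_fst fun z hz ↦ hz.1
  exact (h1.clm_apply contDiffOn_snd).prodMk
    ((contDiffOn_snd.clm_comp (contDiffOn_fderiv_flip_apply hW hB)).const_smul _).neg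

/-- The momentum component of the Hamiltonian field is quadratic in the momentum. -/
lemma hasFDerivAt_hamiltonianField_snd {B : V → (V →L[ℝ] ℝ) →L[ℝ] V} {W : Set V} (hW : IsOpen W)
    (hB : ContDiffOn ℝ ∞ B W) {u₀ : V} (hu₀ : u₀ ∈ W) :
    HasFDerivAt (fun z ↦ (hamiltonianField B z).2)
      (0 : V × (V →L[ℝ] ℝ) →L[ℝ] (V →L[ℝ] ℝ)) (u₀, 0) := by
  have h1 := (((contDiffOn_fderiv_flip_apply hW hB).contDiffAt
    ((hW.prod isOpen_univ).mem_nhds (x := (u₀, (0 : V →L[ℝ] ℝ))) ⟨hu₀, mem_univ _⟩)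
      ).differentiableAt (by simp)).hasFDerivAt
  have h2 := ((hasFDerivAt_snd (𝕜 := ℝ) (p := (u₀, (0 : V →L[ℝ] ℝ)))).clm_comp h1).const_smul
    (1 / 2 : ℝ) |>.neg
  refine h2.congr_fderiv ?_
  simp

variable [FiniteDimensional ℝ V]

/-- The time-one cogeodesic flow near a zero covector: smoothness, conservation of energy, and the
first variation formula, which is the content of the Gauss lemma. -/
theorem exists_cogeodesic_flow {B : V → (V →L[ℝ] ℝ) →L[ℝ] V} {W : Set V} (hW : IsOpen W)
    (hB : ContDiffOn ℝ ∞ B W) (hs : ∀ q ∈ W, ∀ p p' : V →L[ℝ] ℝ, p (B q p') = p' (B q p))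
    {u₀ : V} (hu₀ : u₀ ∈ W) :
    ∃ r > 0, ∃ Γ : V × (V →L[ℝ] ℝ) → ℝ → V × (V →L[ℝ] ℝ),
      ContDiffOn ℝ ∞ (fun z ↦ Γ z 1) (Metric.ball (u₀, 0) r) ∧
      (∀ z ∈ Metric.ball (u₀, (0 : V →L[ℝ] ℝ)) r, Γ z 0 = z ∧ ContDiffOn ℝ 1 (Γ z) (Icc 0 1) ∧
        (∀ t ∈ Icc (0 : ℝ) 1, (Γ z t).1 ∈ W ∧
          HasDerivWithinAt (fun t ↦ (Γ z t).1) (B (Γ z t).1 (Γ z t).2) (Icc 0 1) t ∧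
          hamiltonian B (Γ z t) = hamiltonian B z) ∧
        ∀ h, (Γ z 1).2 (fderiv ℝ (fun z ↦ Γ z 1) z h).1 - z.2 h.1 =
          fderiv ℝ (hamiltonian B) z h) ∧
      Γ (u₀, 0) 1 = (u₀, 0) ∧
      ∀ a b, fderiv ℝ (fun z ↦ Γ z 1) (u₀, 0) (a, b) = (a + B u₀ b, b) := by
  obtain ⟨X, hX, ρ, hρ, hρW, hXeq⟩ := exists_contDiff_eqOn_ball (hW.prod isOpen_univ)
    (contDiffOn_hamiltonianField hW hB) (a := (u₀, (0 : V →L[ℝ] ℝ))) ⟨hu₀, mem_univ _⟩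
  have hBd : ∀ q ∈ W, DifferentiableAt ℝ B q := fun q hq ↦
    (hB.contDiffAt (hW.mem_nhds hq)).differentiableAt (by simp)
  have hXfst : ∀ z ∈ Metric.ball (u₀, (0 : V →L[ℝ] ℝ)) ρ, ∀ h,
      (fderiv ℝ X z h).1 = B z.1 h.2 + fderiv ℝ B z.1 h.1 z.2 := by
    intro z hz h
    have h1 : HasFDerivAt (fun z ↦ (X z).1) _ z :=
      (hX.differentiable (by simp) z).hasFDerivAt.fst
    have h2 := (hasFDerivAt_velocity (hBd z.1 (hρW hz).1)).congr_of_eventuallyEq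
      (f₁ := fun z ↦ (X z).1) (by
        filter_upwards [Metric.isOpen_ball.mem_nhds hz] with y hy
        rw [hXeq hy, hamiltonianField])
    have h3 := DFunLike.congr_fun (h1.unique h2) h
    simpa using h3
  have hz₀ : (u₀, (0 : V →L[ℝ] ℝ)) ∈ Metric.ball (u₀, (0 : V →L[ℝ] ℝ)) ρ :=
    Metric.mem_ball_self hρ
  have hX₀ : X (u₀, 0) = 0 := by
    rw [hXeq hz₀, hamiltonianField]
    simp
  have hXsnd : ∀ h, (fderiv ℝ X (u₀, 0) h).2 = 0 := by
    intro h
    have hq : HasFDerivAt (fun z ↦ (X z).2)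
        (0 : V × (V →L[ℝ] ℝ) →L[ℝ] (V →L[ℝ] ℝ)) (u₀, (0 : V →L[ℝ] ℝ)) := by
      refine (hasFDerivAt_hamiltonianField_snd hW hB hu₀).congr_of_eventuallyEq ?_
      filter_upwards [Metric.isOpen_ball.mem_nhds hz₀] with y hy
      rw [hXeq hy]
    have h1 : HasFDerivAt (fun z ↦ (X z).2) _ (u₀, (0 : V →L[ℝ] ℝ)) :=
      (hX.differentiable (by simp) _).hasFDerivAt.snd
    exact DFunLike.congr_fun (h1.unique hq) h
  have hX'₀ : ∀ h, fderiv ℝ X (u₀, 0) h = (B u₀ h.2, 0) := fun h ↦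
    Prod.ext (by simp [hXfst _ hz₀]) (hXsnd h)
  obtain ⟨r, hr, Γ, hsm, hΓ, hΓ₀, hΓ'⟩ := exists_smooth_flow hX hX₀
    (fun h ↦ by rw [hX'₀, hX'₀]; simp) hρ
  refine ⟨r, hr, Γ, hsm 1, fun z hz ↦ ?_, hΓ₀, fun a b ↦ by rw [hΓ', hX'₀]; simp⟩
  have hconst : ∀ {f : ℝ → ℝ}, (∀ t ∈ Icc (0 : ℝ) 1, HasDerivWithinAt f 0 (Icc 0 1) t) →
      ∀ t ∈ Icc (0 : ℝ) 1, f t = f 0 := by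
    intro f hf t ht
    refine constant_of_has_deriv_right_zero (fun s hs ↦ (hf s hs).continuousWithinAt)
      (fun s hs ↦ ?_) t ht
    exact (hf s ⟨hs.1, hs.2.le⟩).mono_of_mem_nhdsWithin (Icc_mem_nhdsGE_of_mem hs)
  -- conservation of energy
  have henergy : ∀ y ∈ Metric.ball (u₀, (0 : V →L[ℝ] ℝ)) r, ∀ t ∈ Icc (0 : ℝ) 1,
      hamiltonian B (Γ y t) = hamiltonian B y := by
    intro y hy t ht
    obtain ⟨hy0, -, hyflow⟩ := hΓ y hy
    have := hconst (f := fun t ↦ hamiltonian B (Γ y t)) (fun s hs' ↦ ?_) t ht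
    · rwa [hy0] at this
    · have hmem : (Γ y s).1 ∈ W := (hρW (hyflow s hs').1).1
      have hH := fun a b ↦ fderiv_hamiltonian (hBd _ hmem) (hs _ hmem) a b
      refine ((hH 0 0).1.hasFDerivAt.comp_hasDerivWithinAt s (hyflow s hs').2.1).congr_deriv ?_
      rw [hXeq (hyflow s hs').1, hamiltonianField, (hH _ _).2, hs _ hmem (Γ y s).2]
      simp
  obtain ⟨hΓz, hC, hflow⟩ := hΓ z hz
  have hmemW : ∀ t ∈ Icc (0 : ℝ) 1, (Γ z t).1 ∈ W := fun t ht ↦ (hρW (hflow t ht).1).1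
  have hvel : ∀ t ∈ Icc (0 : ℝ) 1,
      HasDerivWithinAt (Γ z) (hamiltonianField B (Γ z t)) (Icc 0 1) t := fun t ht ↦ by
    rw [← hXeq (hflow t ht).1]
    exact (hflow t ht).2.1
  refine ⟨hΓz, hC, fun t ht ↦ ⟨hmemW t ht,
    (hvel t ht).hasFDerivWithinAt.fst.hasDerivWithinAt.congr_deriv ?_, henergy z hz t ht⟩,
    fun h ↦ ?_⟩
  · simp [hamiltonianField]
  · -- the pairing of the momentum with the variation of the position grows at constant speed
    let w : ℝ → V × (V →L[ℝ] ℝ) := fun t ↦ fderiv ℝ (fun z ↦ Γ z t) z h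
    have hw : ∀ t ∈ Icc (0 : ℝ) 1, HasDerivWithinAt w (fderiv ℝ X (Γ z t) (w t)) (Icc 0 1) t :=
      fun t ht ↦ (hflow t ht).2.2 h
    have hw₀ : w 0 = h := by
      have : (fun z ↦ Γ z 0) =ᶠ[𝓝 z] id := by
        filter_upwards [Metric.isOpen_ball.mem_nhds hz] with y hy
        exact (hΓ y hy).1
      simp only [w, this.fderiv_eq, fderiv_id]
      rfl
    have hE : ∀ t ∈ Icc (0 : ℝ) 1,
        fderiv ℝ (hamiltonian B) (Γ z t) (w t) = fderiv ℝ (hamiltonian B) z h := by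
      intro t ht
      have hdH := (fderiv_hamiltonian (hBd _ (hmemW t ht)) (hs _ (hmemW t ht)) 0 0).1
      have hdΓ : DifferentiableAt ℝ (fun z ↦ Γ z t) z :=
        ((hsm t).contDiffAt (Metric.isOpen_ball.mem_nhds hz)).differentiableAt (by simp)
      have h1 := (hdH.hasFDerivAt.comp z hdΓ.hasFDerivAt).fderiv
      have h2 : (hamiltonian B ∘ fun z ↦ Γ z t) =ᶠ[𝓝 z] hamiltonian B := by
        filter_upwards [Metric.isOpen_ball.mem_nhds hz] with y hy
        exact henergy y hy t ht
      rw [h2.fderiv_eq] at h1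
      exact (DFunLike.congr_fun h1 h).symm
    have hpair : ∀ t ∈ Icc (0 : ℝ) 1, HasDerivWithinAt
        (fun t ↦ (Γ z t).2 (w t).1 - t * fderiv ℝ (hamiltonian B) z h) 0 (Icc 0 1) t := by
      intro t ht
      have hp : HasDerivWithinAt (fun t ↦ (Γ z t).2) _ (Icc 0 1) t :=
        (hvel t ht).hasFDerivWithinAt.snd.hasDerivWithinAt
      have ha : HasDerivWithinAt (fun t ↦ (w t).1) _ (Icc 0 1) t :=
        (hw t ht).hasFDerivWithinAt.fst.hasDerivWithinAt
      refine ((hp.clm_apply ha).sub ((hasDerivWithinAt_id t _).mul_const _)).congr_deriv ?_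
      have := (fderiv_hamiltonian (hBd _ (hmemW t ht)) (hs _ (hmemW t ht)) (w t).1 (w t).2).2
      rw [← hE t ht, this]
      simp [hamiltonianField, hXfst _ (hflow t ht).1]
      ring
    have h1 := hconst hpair 1 (right_mem_Icc.2 zero_le_one)
    simp only [hΓz, hw₀, one_mul, zero_mul, sub_zero] at h1
    linarith

end Hamiltonian

/-! ### Half the squared distance to a linear slice: the eikonal equation -/

section Eikonal

set_option maxSynthPendingDepth 5

universe u

lemma isInvertible_of_injective {A B : Type*} [NormedAddCommGroup A] [NormedSpace ℝ A]
    [FiniteDimensional ℝ A] [NormedAddCommGroup B] [NormedSpace ℝ B] [FiniteDimensional ℝ B]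
    (L : A →L[ℝ] B) (hL : Function.Injective L)
    (hdim : Module.finrank ℝ A = Module.finrank ℝ B) : L.IsInvertible :=
  ⟨(LinearMap.linearEquivOfInjective (L : A →ₗ[ℝ] B) hL hdim).toContinuousLinearEquiv, by
    ext x
    rfl⟩

lemma finrank_dual (A : Type*) [NormedAddCommGroup A] [NormedSpace ℝ A] [FiniteDimensional ℝ A] :
    Module.finrank ℝ (A →L[ℝ] ℝ) = Module.finrank ℝ A := by
  rw [← (LinearMap.toContinuousLinearMap (𝕜 := ℝ) (E := A) (F' := ℝ)).finrank_eq]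
  exact Subspace.dual_finrank_eq

variable {V : Type u} [NormedAddCommGroup V] [NormedSpace ℝ V] [FiniteDimensional ℝ V]

lemma isInvertible_of_posDef {g : V →L[ℝ] V →L[ℝ] ℝ} (hpos : ∀ a, a ≠ 0 → 0 < g a a) :
    g.IsInvertible := by
  refine isInvertible_of_injective g ((injective_iff_map_eq_zero g).2 fun a ha ↦ ?_)
    (finrank_dual V).symm
  by_contra h
  have := hpos a h
  simp [ha] at this

lemma apply_inverse_of_posDef {g : V →L[ℝ] V →L[ℝ] ℝ} (hpos : ∀ a, a ≠ 0 → 0 < g a a)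
    (θ : V →L[ℝ] ℝ) : g (g.inverse θ) = θ := by
  obtain ⟨e, he⟩ := isInvertible_of_posDef hpos
  rw [← he, ContinuousLinearMap.inverse_equiv]
  simp

lemma inverse_apply_of_posDef {g : V →L[ℝ] V →L[ℝ] ℝ} (hpos : ∀ a, a ≠ 0 → 0 < g a a)
    (v : V) : g.inverse (g v) = v := by
  obtain ⟨e, he⟩ := isInvertible_of_posDef hpos
  rw [← he, ContinuousLinearMap.inverse_equiv]
  simp

lemma contDiffOn_inverse_of_posDef {G : V → V →L[ℝ] V →L[ℝ] ℝ} {W : Set V}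
    (hG : ContDiffOn ℝ ∞ G W) (hpos : ∀ q ∈ W, ∀ a, a ≠ 0 → 0 < G q a a) :
    ContDiffOn ℝ ∞ (fun q ↦ (G q).inverse) W := fun q hq ↦
  (isInvertible_of_posDef (hpos q hq)).contDiffAt_map_inverse.comp_contDiffWithinAt q (hG q hq)

variable {F : Type*} [NormedAddCommGroup F] [NormedSpace ℝ F] [FiniteDimensional ℝ F]
  {C : Type*} [NormedAddCommGroup C] [NormedSpace ℝ C] [FiniteDimensional ℝ C]

/-- The parametrization of the conormal bundle of the slice `J (F × 0)` by `F × C*`. -/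
noncomputable def conormal (J : (F × C) ≃L[ℝ] V) : F × (C →L[ℝ] ℝ) →L[ℝ] V × (V →L[ℝ] ℝ) :=
  (((J : F × C →L[ℝ] V).comp (ContinuousLinearMap.inl ℝ F C)).comp
      (ContinuousLinearMap.fst ℝ F (C →L[ℝ] ℝ))).prod
    (((ContinuousLinearMap.compL ℝ V C ℝ).flip
      ((ContinuousLinearMap.snd ℝ F C).comp (J.symm : V →L[ℝ] F × C))).comp
        (ContinuousLinearMap.snd ℝ F (C →L[ℝ] ℝ)))

omit [FiniteDimensional ℝ V] [FiniteDimensional ℝ F] [FiniteDimensional ℝ C] in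
lemma conormal_fst (J : (F × C) ≃L[ℝ] V) (y : F × (C →L[ℝ] ℝ)) :
    (conormal J y).1 = J (y.1, 0) := rfl

omit [FiniteDimensional ℝ V] [FiniteDimensional ℝ F] [FiniteDimensional ℝ C] in
lemma conormal_snd_apply (J : (F × C) ≃L[ℝ] V) (y : F × (C →L[ℝ] ℝ)) (v : V) :
    (conormal J y).2 v = y.2 (J.symm v).2 := rfl

omit [FiniteDimensional ℝ V] [FiniteDimensional ℝ F] [FiniteDimensional ℝ C] in
lemma conormal_mk_zero (J : (F × C) ≃L[ℝ] V) (s : F) : conormal J (s, 0) = (J (s, 0), 0) := rfl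

/-- A local solution `f` of the eikonal equation `|∇f|² = 2f` of a metric `G`, vanishing on the
slice `J (F × 0)`. It is the kinetic energy of the initial covector of the normal geodesic ending
at the given point; these geodesics are the curves `q` of the statement, and the Gauss lemma says
that `Df` at the endpoint of a geodesic is its final momentum. The last two conclusions say
that the second derivative of `f` at the base point is the metric on the normal space, extended by
zero to the tangent space of the slice. -/
theorem exists_eikonal (J : (F × C) ≃L[ℝ] V) {G : V → V →L[ℝ] V →L[ℝ] ℝ} {W : Set V}
    (hW : IsOpen W) (hG : ContDiffOn ℝ ∞ G W) (hsymm : ∀ q ∈ W, ∀ a b, G q a b = G q b a)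
    (hpos : ∀ q ∈ W, ∀ a, a ≠ 0 → 0 < G q a a) {s₀ : F} (hu₀ : J (s₀, 0) ∈ W) :
    ∃ U ⊆ W, IsOpen U ∧ J (s₀, 0) ∈ U ∧ ∃ f : V → ℝ, ContDiffOn ℝ ∞ f U ∧
      (∀ s, J (s, 0) ∈ U → f (J (s, 0)) = 0) ∧
      (∀ u ∈ U, ∃ v, G u v = fderiv ℝ f u ∧ G u v v = 2 * f u) ∧
      (∀ u ∈ U, ∃ q : ℝ → V, ∃ s, q 0 = J (s, 0) ∧ q 1 = u ∧ ContDiffOn ℝ 1 q (Icc 0 1) ∧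
        ∀ t ∈ Icc (0 : ℝ) 1, q t ∈ W ∧
          ∃ v, HasDerivWithinAt q v (Icc 0 1) t ∧ G (q t) v v = 2 * f u) ∧
      (∀ a, fderiv ℝ (fderiv ℝ f) (J (s₀, 0)) (J (a, 0)) = 0) ∧
      ∀ v, (∀ a, G (J (s₀, 0)) v (J (a, 0)) = 0) →
        fderiv ℝ (fderiv ℝ f) (J (s₀, 0)) v = G (J (s₀, 0)) v := by
  let B : V → (V →L[ℝ] ℝ) →L[ℝ] V := fun q ↦ (G q).inverse
  have hB : ContDiffOn ℝ ∞ B W := contDiffOn_inverse_of_posDef hG hpos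
  have hGB : ∀ q ∈ W, ∀ θ, G q (B q θ) = θ := fun q hq θ ↦ apply_inverse_of_posDef (hpos q hq) θ
  have hBsymm : ∀ q ∈ W, ∀ p p' : V →L[ℝ] ℝ, p (B q p') = p' (B q p) := by
    intro q hq p p'
    conv_lhs => rw [← hGB q hq p]
    conv_rhs => rw [← hGB q hq p']
    exact hsymm q hq _ _
  obtain ⟨r, hr, Γ, hsm, hΓ, hΓ₀, hΓ'⟩ := exists_cogeodesic_flow hW hB hBsymm hu₀
  let ι := conormal J
  have hι₀ : ι (s₀, 0) = (J (s₀, 0), 0) := conormal_mk_zero J s₀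
  let O : Set (F × (C →L[ℝ] ℝ)) := ι ⁻¹' Metric.ball (J (s₀, 0), 0) r
  have hO : IsOpen O := Metric.isOpen_ball.preimage ι.continuous
  have hy₀ : ((s₀, 0) : F × (C →L[ℝ] ℝ)) ∈ O := by
    rw [mem_preimage, hι₀]
    exact Metric.mem_ball_self hr
  let E : F × (C →L[ℝ] ℝ) → V × (V →L[ℝ] ℝ) := fun y ↦ Γ (ι y) 1
  have hE : ContDiffOn ℝ ∞ E O := hsm.comp ι.contDiff.contDiffOn fun y hy ↦ hy
  have hE' : ∀ y ∈ O, HasFDerivAt E ((fderiv ℝ (fun z ↦ Γ z 1) (ι y)).comp ι) y := fun y hy ↦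
    ((hsm.contDiffAt (Metric.isOpen_ball.mem_nhds hy)).differentiableAt
      (by simp)).hasFDerivAt.comp y ι.hasFDerivAt
  have hEQ : ContDiffOn ℝ ∞ (fun y ↦ (E y).1) O := contDiff_fst.comp_contDiffOn hE
  -- the differential of the normal exponential map at the base point
  let Q₀ : F × (C →L[ℝ] ℝ) →L[ℝ] V := (ContinuousLinearMap.fst ℝ V (V →L[ℝ] ℝ)).comp
    ((fderiv ℝ (fun z ↦ Γ z 1) (ι (s₀, 0))).comp ι)
  have hQ₀app : ∀ y, Q₀ y = J (y.1, 0) + B (J (s₀, 0)) (ι y).2 := by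
    intro y
    change (fderiv ℝ (fun z ↦ Γ z 1) (ι (s₀, 0)) ((ι y).1, (ι y).2)).1 = _
    rw [hι₀, hΓ']
    rfl
  have hQ₀inj : Function.Injective Q₀ := by
    refine (injective_iff_map_eq_zero Q₀).2 fun y hy ↦ ?_
    rw [hQ₀app] at hy
    have h1 : (ι y).2 (B (J (s₀, 0)) (ι y).2) = 0 := by
      have := congrArg (ι y).2 hy
      rw [map_add, map_zero] at this
      have h2 : (ι y).2 (J (y.1, 0)) = 0 := by
        rw [conormal_snd_apply]
        simp
      linarith
    have h2 : B (J (s₀, 0)) (ι y).2 = 0 := by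
      by_contra h
      have h3 := hpos _ hu₀ _ h
      rw [hGB _ hu₀, h1] at h3
      exact lt_irrefl _ h3
    have h3 : (ι y).2 = 0 := by
      rw [← hGB _ hu₀ (ι y).2, h2, map_zero]
    rw [h2, add_zero] at hy
    refine Prod.ext ?_ (ContinuousLinearMap.ext fun c ↦ ?_)
    · have : (y.1, (0 : C)) = (0, 0) := J.injective (by rw [hy, Prod.mk_zero_zero, map_zero])
      exact (Prod.ext_iff.1 this).1
    · have := DFunLike.congr_fun h3 (J (0, c))
      rw [conormal_snd_apply] at this
      simpa using this
  have hdim : Module.finrank ℝ (F × (C →L[ℝ] ℝ)) = Module.finrank ℝ V := by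
    rw [← J.toLinearEquiv.finrank_eq, Module.finrank_prod, Module.finrank_prod, finrank_dual]
  obtain ⟨e, he⟩ := isInvertible_of_injective Q₀ hQ₀inj hdim
  obtain ⟨Φ, hΦ, hmem, hsub, hinv, hsymmΦ⟩ := exists_smooth_localInverse hO hEQ hy₀ e
    (by rw [he]; exact (hE' _ hy₀).fst)
  have hΓrest : ∀ s, (s, 0) ∈ O → (E (s, 0)).1 = J (s, 0) := by
    intro s hs
    obtain ⟨h0, hC, hcurve, -⟩ := hΓ _ hs
    have hzero : hamiltonian B (ι (s, 0)) = 0 := by simp [hamiltonian, ι, conormal_mk_zero]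
    have hv : ∀ t ∈ Icc (0 : ℝ) 1, B (Γ (ι (s, 0)) t).1 (Γ (ι (s, 0)) t).2 = 0 := by
      intro t ht
      obtain ⟨hw, -, hen⟩ := hcurve t ht
      by_contra h
      have h3 := hpos _ hw _ h
      rw [hGB _ hw] at h3
      rw [hzero, hamiltonian] at hen
      linarith
    have := constant_of_has_deriv_right_zero (f := fun t ↦ (Γ (ι (s, 0)) t).1) (a := 0) (b := 1)
      (fun t ht ↦ (hcurve t ht).2.1.continuousWithinAt) (fun t ht ↦ by
        have h1 := (hcurve t ⟨ht.1, ht.2.le⟩).2.1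
        rw [hv t ⟨ht.1, ht.2.le⟩] at h1
        exact h1.mono_of_mem_nhdsWithin (Icc_mem_nhdsGE_of_mem ht)) 1 (right_mem_Icc.2 zero_le_one)
    rw [h0] at this
    exact this
  have hΦ₀ : Φ (s₀, 0) = J (s₀, 0) := by rw [hΦ]; exact hΓrest s₀ hy₀
  have hmemT : J (s₀, 0) ∈ Φ.target := by
    rw [← hΦ₀]
    exact Φ.map_source hmem
  -- points of the slice in `U` have to be reached by the constant geodesic
  let U : Set V := Φ.target ∩ ((fun u ↦ ((J.symm u).1, (0 : C →L[ℝ] ℝ))) ⁻¹' Φ.source)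
  have hU : IsOpen U := Φ.open_target.inter (Φ.open_source.preimage
    ((continuous_fst.comp J.symm.continuous).prodMk continuous_const))
  let f : V → ℝ := fun u ↦ hamiltonian B (ι (Φ.symm u))
  have hιW : ∀ y ∈ O, (ι y).1 ∈ W := by
    intro y hy
    obtain ⟨h0, -, hcurve, -⟩ := hΓ _ hy
    have := (hcurve 0 (left_mem_Icc.2 zero_le_one)).1
    rwa [h0] at this
  have hR : ∀ u ∈ U, Φ.symm u ∈ O := fun u hu ↦ hsub (Φ.map_target hu.1)
  have hER : ∀ u ∈ U, (E (Φ.symm u)).1 = u := fun u hu ↦ by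
    have := Φ.right_inv hu.1
    rwa [hΦ] at this
  have hf : ContDiffOn ℝ ∞ f U :=
    (contDiffOn_hamiltonian hB).comp
      (ι.contDiff.comp_contDiffOn (hsymmΦ.mono inter_subset_left))
      fun u hu ↦ ⟨hιW _ (hR u hu), mem_univ _⟩
  have hfΦ : ∀ y ∈ Φ.source, f (E y).1 = hamiltonian B (ι y) := by
    intro y hy
    have := Φ.left_inv hy
    rw [hΦ] at this
    simp only [f, this]
  -- the Gauss lemma
  have hfd : ∀ y ∈ Φ.source, (E y).1 ∈ U → fderiv ℝ f (E y).1 = (E y).2 := by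
    intro y hy hyU
    have hdf : HasFDerivAt f (fderiv ℝ f (E y).1) (E y).1 :=
      ((hf.contDiffAt (hU.mem_nhds hyU)).differentiableAt (by simp)).hasFDerivAt
    have hyO := hsub hy
    have hQ := (hE' y hyO).fst
    have h1 := hdf.comp y hQ
    have hHd : DifferentiableAt ℝ (hamiltonian B) (ι y) :=
      ((contDiffOn_hamiltonian hB).contDiffAt ((hW.prod isOpen_univ).mem_nhds
        ⟨hιW y hyO, mem_univ _⟩)).differentiableAt (by simp)
    have h2 : HasFDerivAt (f ∘ fun y ↦ (E y).1) ((fderiv ℝ (hamiltonian B) (ι y)).comp ι) y := by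
      refine (hHd.hasFDerivAt.comp y ι.hasFDerivAt).congr_of_eventuallyEq ?_
      filter_upwards [Φ.open_source.mem_nhds hy] with y' hy'
      exact hfΦ y' hy'
    have h3 := h1.unique h2
    obtain ⟨e', he'⟩ := hinv y hy
    rw [hQ.fderiv] at he'
    ext v
    have h4 := DFunLike.congr_fun h3 (e'.symm v)
    have h5 : (fderiv ℝ (fun z ↦ Γ z 1) (ι y) (ι (e'.symm v))).1 = v := by
      have := DFunLike.congr_fun he' (e'.symm v)
      simpa using this.symm
    have h6 := (hΓ _ hyO).2.2.2 (ι (e'.symm v))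
    have h7 : (ι y).2 (ι (e'.symm v)).1 = 0 := by
      rw [conormal_snd_apply, conormal_fst]
      simp
    rw [h5, h7, sub_zero] at h6
    simp only [ContinuousLinearMap.comp_apply, ContinuousLinearMap.coe_fst'] at h4
    rw [h5, ← h6] at h4
    exact h4
  have hu₀U : J (s₀, 0) ∈ U := ⟨hmemT, by simpa using hmem⟩
  have hfdU : ∀ u ∈ U, fderiv ℝ f u = (E (Φ.symm u)).2 := fun u hu ↦ by
    have := hfd (Φ.symm u) (Φ.map_target hu.1) (by rwa [hER u hu])
    rwa [hER u hu] at this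
  have hUW : U ⊆ W := fun u hu ↦ by
    have := ((hΓ _ (hR u hu)).2.2.1 1 (right_mem_Icc.2 zero_le_one)).1
    change (E (Φ.symm u)).1 ∈ W at this
    rwa [hER u hu] at this
  -- the second derivative at the base point
  have hsecond : ∀ y, fderiv ℝ (fderiv ℝ f) (J (s₀, 0)) (Q₀ y) = (ι y).2 := by
    intro y
    have hE₀ : (E (s₀, 0)).1 = J (s₀, 0) := hΓrest s₀ hy₀
    have hd2 : HasFDerivAt (fderiv ℝ f) (fderiv ℝ (fderiv ℝ f) (J (s₀, 0))) (E (s₀, 0)).1 := by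
      rw [hE₀]
      exact (((hf.fderiv_of_isOpen hU (m := ∞) (by simp)).contDiffAt
        (hU.mem_nhds hu₀U)).differentiableAt (by simp)).hasFDerivAt
    have h1 := hd2.comp (s₀, 0) (hE' _ hy₀).fst
    have h2 : HasFDerivAt (fderiv ℝ f ∘ fun y ↦ (E y).1) _ (s₀, 0) :=
      (hE' _ hy₀).snd.congr_of_eventuallyEq (by
        have : (fun y ↦ (E y).1) ⁻¹' U ∈ 𝓝 ((s₀, 0) : F × (C →L[ℝ] ℝ)) := by
          refine (hE' _ hy₀).fst.continuousAt.preimage_mem_nhds ?_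
          rw [hE₀]
          exact hU.mem_nhds hu₀U
        filter_upwards [Φ.open_source.mem_nhds hmem, this] with y' hy' hy''
        exact hfd y' hy' hy'')
    have h3 := DFunLike.congr_fun (h1.unique h2) y
    refine h3.trans ?_
    change (fderiv ℝ (fun z ↦ Γ z 1) (ι (s₀, 0)) ((ι y).1, (ι y).2)).2 = _
    rw [hι₀, hΓ']
  refine ⟨U, hUW, hU, hu₀U, f, hf, fun s hs ↦ ?_, fun u hu ↦ ?_, fun u hu ↦ ?_, fun a ↦ ?_,
    fun v hv ↦ ?_⟩
  · have hs' : (s, 0) ∈ Φ.source := by simpa using hs.2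
    have := hfΦ _ hs'
    rw [hΓrest s (hsub hs')] at this
    rw [this]
    simp [hamiltonian, ι, conormal_mk_zero]
  · have hen := ((hΓ _ (hR u hu)).2.2.1 1 (right_mem_Icc.2 zero_le_one)).2.2
    change hamiltonian B (E (Φ.symm u)) = f u at hen
    rw [hamiltonian, hER u hu] at hen
    refine ⟨B u (E (Φ.symm u)).2, by rw [hGB u (hUW hu), hfdU u hu], ?_⟩
    rw [hGB u (hUW hu), ← hen]
    ring
  · obtain ⟨h0, hC, hcurve, -⟩ := hΓ _ (hR u hu)
    refine ⟨fun t ↦ (Γ (ι (Φ.symm u)) t).1, (Φ.symm u).1, ?_, hER u hu,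
      contDiff_fst.comp_contDiffOn hC, fun t ht ↦ ?_⟩
    · simp only [h0]
      rfl
    · obtain ⟨hw, hd, hen⟩ := hcurve t ht
      refine ⟨hw, _, hd, ?_⟩
      rw [hGB _ hw]
      change _ = 2 * hamiltonian B (ι (Φ.symm u))
      rw [← hen, hamiltonian]
      ring
  · have := hsecond (a, 0)
    rw [hQ₀app, show ι (a, 0) = (J (a, 0), 0) from conormal_mk_zero J a] at this
    simpa using this
  · let β : C →L[ℝ] ℝ := (G (J (s₀, 0)) v).comp
      ((J : F × C →L[ℝ] V).comp (ContinuousLinearMap.inr ℝ F C))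
    have hβ : (ι (0, β)).2 = G (J (s₀, 0)) v := by
      ext w
      rw [conormal_snd_apply]
      change G (J (s₀, 0)) v (J (0, (J.symm w).2)) = _
      have h1 : w = J ((J.symm w).1, 0) + J (0, (J.symm w).2) := by
        rw [← map_add]
        simp
      conv_rhs => rw [h1, map_add, hv, zero_add]
    have := hsecond (0, β)
    rw [hQ₀app, hβ] at this
    simp only [B, inverse_apply_of_posDef (hpos _ hu₀)] at this
    rw [← this]
    congr 1
    change v = J (0 : F × C) + v
    simp

end Eikonal

/-! ### Differentials of charts -/

section Charts

set_option maxSynthPendingDepth 5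

variable {E : Type*} [NormedAddCommGroup E] [NormedSpace ℝ E]
  {X : Type*} [TopologicalSpace X] [ChartedSpace E X]

/-- The differential of a chart, with values in the model space. -/
noncomputable def chartDeriv (e : OpenPartialHomeomorph X E) (x : X) :
    TangentSpace 𝓘(ℝ, E) x →L[ℝ] E :=
  mfderiv 𝓘(ℝ, E) 𝓘(ℝ, E) e x

/-- The differential of the inverse of a chart, defined on the model space. -/
noncomputable def symmDeriv (e : OpenPartialHomeomorph X E) (u : E) :
    E →L[ℝ] TangentSpace 𝓘(ℝ, E) (e.symm u) :=
  mfderiv 𝓘(ℝ, E) 𝓘(ℝ, E) e.symm u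

variable {e e' : OpenPartialHomeomorph X E}

lemma mdifferentiable_of_mem_maximalAtlas (he : e ∈ IsManifold.maximalAtlas 𝓘(ℝ, E) ∞ X) :
    e.MDifferentiable 𝓘(ℝ, E) 𝓘(ℝ, E) :=
  ⟨(contMDiffOn_of_mem_maximalAtlas he).mdifferentiableOn (by simp),
    (contMDiffOn_symm_of_mem_maximalAtlas he).mdifferentiableOn (by simp)⟩

lemma chartDeriv_symmDeriv (he : e ∈ IsManifold.maximalAtlas 𝓘(ℝ, E) ∞ X) {u : E}
    (hu : u ∈ e.target) (a : E) : chartDeriv e (e.symm u) (symmDeriv e u a) = a :=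
  DFunLike.congr_fun ((mdifferentiable_of_mem_maximalAtlas he).comp_symm_deriv hu) a

lemma symmDeriv_injective (he : e ∈ IsManifold.maximalAtlas 𝓘(ℝ, E) ∞ X) {u : E}
    (hu : u ∈ e.target) : Function.Injective (symmDeriv e u) :=
  Function.LeftInverse.injective (chartDeriv_symmDeriv he hu)

lemma symmDeriv_surjective (he : e ∈ IsManifold.maximalAtlas 𝓘(ℝ, E) ∞ X) {u : E}
    (hu : u ∈ e.target) : Function.Surjective (symmDeriv e u) :=
  (mdifferentiable_of_mem_maximalAtlas he).symm.mfderiv_surjective hu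

lemma symmDeriv_chartDeriv (he : e ∈ IsManifold.maximalAtlas 𝓘(ℝ, E) ∞ X) {u : E}
    (hu : u ∈ e.target) (v : TangentSpace 𝓘(ℝ, E) (e.symm u)) :
    symmDeriv e u (chartDeriv e (e.symm u) v) = v := by
  obtain ⟨a, rfl⟩ := symmDeriv_surjective he hu v
  rw [chartDeriv_symmDeriv he hu]

/-- The chain rule for a function read in a chart. -/
lemma hasFDerivAt_comp_symm (he : e ∈ IsManifold.maximalAtlas 𝓘(ℝ, E) ∞ X) {u : E}
    (hu : u ∈ e.target) {f : X → ℝ} (hf : MDifferentiableAt 𝓘(ℝ, E) 𝓘(ℝ, ℝ) f (e.symm u)) :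
    HasFDerivAt (fun y ↦ f (e.symm y))
      ((mvfderiv 𝓘(ℝ, E) f (e.symm u)).comp (symmDeriv e u)) u := by
  have h := hf.hasMFDerivAt.comp u
    ((mdifferentiable_of_mem_maximalAtlas he).mdifferentiableAt_symm hu).hasMFDerivAt
  exact h.hasFDerivAt

/-- The differential of a change of charts. -/
lemma hasFDerivAt_transition (he : e ∈ IsManifold.maximalAtlas 𝓘(ℝ, E) ∞ X)
    (he' : e' ∈ IsManifold.maximalAtlas 𝓘(ℝ, E) ∞ X) {u : E}
    (hu : u ∈ e.target) (hu' : e.symm u ∈ e'.source) :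
    HasFDerivAt (fun y ↦ e' (e.symm y)) ((chartDeriv e' (e.symm u)).comp (symmDeriv e u)) u := by
  have h := ((mdifferentiable_of_mem_maximalAtlas he').mdifferentiableAt hu').hasMFDerivAt.comp u
    ((mdifferentiable_of_mem_maximalAtlas he).mdifferentiableAt_symm hu).hasMFDerivAt
  exact h.hasFDerivAt

lemma contDiffAt_transition (he : e ∈ IsManifold.maximalAtlas 𝓘(ℝ, E) ∞ X)
    (he' : e' ∈ IsManifold.maximalAtlas 𝓘(ℝ, E) ∞ X) {u : E}
    (hu : u ∈ e.target) (hu' : e.symm u ∈ e'.source) :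
    ContDiffAt ℝ ∞ (fun y ↦ e' (e.symm y)) u := by
  have h1 := (contMDiffOn_symm_of_mem_maximalAtlas he).contMDiffAt (e.open_target.mem_nhds hu)
  have h2 := (contMDiffOn_of_mem_maximalAtlas he').contMDiffAt (e'.open_source.mem_nhds hu')
  exact (h2.comp u h1).contDiffAt

end Charts

/-! ### The metric and the gradient in a chart -/

section Metric

set_option maxSynthPendingDepth 5

variable {E : Type*} [NormedAddCommGroup E] [NormedSpace ℝ E]
  {X : Type*} [EMetricSpace X] [ChartedSpace E X] {e e' : OpenPartialHomeomorph X E}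

lemma fieldInChart_apply (e : OpenPartialHomeomorph X E) (Y : ∀ x : X, TangentSpace 𝓘(ℝ, E) x)
    (u : E) : fieldInChart e Y u = chartDeriv e (e.symm u) (Y (e.symm u)) := rfl

variable [RiemannianBundle (fun x : X ↦ TangentSpace 𝓘(ℝ, E) x)]

lemma metricInChart_apply (e : OpenPartialHomeomorph X E) (u a b : E) :
    metricInChart e u a b = inner ℝ (symmDeriv e u a) (symmDeriv e u b) := rfl

lemma metricInChart_symm (e : OpenPartialHomeomorph X E) (u a b : E) :
    metricInChart e u a b = metricInChart e u b a := by
  rw [metricInChart_apply, metricInChart_apply, real_inner_comm]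

lemma metricInChart_pos (he : e ∈ IsManifold.maximalAtlas 𝓘(ℝ, E) ∞ X) {u : E}
    (hu : u ∈ e.target) (a : E) (ha : a ≠ 0) : 0 < metricInChart e u a a := by
  rw [metricInChart_apply]
  exact real_inner_self_pos.2 fun h ↦ ha (symmDeriv_injective he hu (by rw [h, map_zero]))

lemma metricInChart_chartDeriv (he : e ∈ IsManifold.maximalAtlas 𝓘(ℝ, E) ∞ X) {x : X}
    (hx : x ∈ e.source) (v w : TangentSpace 𝓘(ℝ, E) x) :
    metricInChart e (e x) (chartDeriv e x v) (chartDeriv e x w) = inner ℝ v w := by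
  obtain ⟨u, hu, rfl⟩ : ∃ u ∈ e.target, x = e.symm u := ⟨e x, e.map_source hx, (e.left_inv hx).symm⟩
  rw [e.right_inv hu, metricInChart_apply, symmDeriv_chartDeriv he hu, symmDeriv_chartDeriv he hu]

variable [FiniteDimensional ℝ E]

lemma inner_gradient (f : X → ℝ) (x : X) (v : TangentSpace 𝓘(ℝ, E) x) :
    inner ℝ (gradient f x) v = mvfderiv 𝓘(ℝ, E) f x v := by
  have := FiniteDimensional.complete ℝ (TangentSpace 𝓘(ℝ, E) x)
  exact InnerProductSpace.toDual_symm_apply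

/-- The gradient in a chart is obtained from the differential by raising the index. -/
lemma metricInChart_gradient (he : e ∈ IsManifold.maximalAtlas 𝓘(ℝ, E) ∞ X) {u : E}
    (hu : u ∈ e.target) {f : X → ℝ} (hf : MDifferentiableAt 𝓘(ℝ, E) 𝓘(ℝ, ℝ) f (e.symm u)) :
    metricInChart e u (fieldInChart e (gradient f) u) = fderiv ℝ (fun y ↦ f (e.symm y)) u := by
  ext b
  rw [(hasFDerivAt_comp_symm he hu hf).fderiv, metricInChart_apply, fieldInChart_apply,
    symmDeriv_chartDeriv he hu, inner_gradient]
  rfl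

variable [IsManifold 𝓘(ℝ, E) ∞ X]
  [IsContMDiffRiemannianBundle 𝓘(ℝ, E) ∞ E (fun x : X ↦ TangentSpace 𝓘(ℝ, E) x)]

lemma contDiffOn_metricInChart (he : e ∈ IsManifold.maximalAtlas 𝓘(ℝ, E) ∞ X) :
    ContDiffOn ℝ ∞ (metricInChart e) e.target := by
  have hsec : ∀ a : E, ContMDiffOn 𝓘(ℝ, E) 𝓘(ℝ, E).tangent ∞
      (fun u ↦ (⟨e.symm u, symmDeriv e u a⟩ : TangentBundle 𝓘(ℝ, E) X)) e.target := by
    intro a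
    have h1 := (contMDiffOn_symm_of_mem_maximalAtlas he).contMDiffOn_tangentMapWithin (m := ∞)
      (by simp) e.open_target.uniqueMDiffOn
    have h2 : ContMDiff 𝓘(ℝ, E) 𝓘(ℝ, E).tangent ∞
        (fun u ↦ (⟨u, a⟩ : TangentBundle 𝓘(ℝ, E) E)) :=
      contMDiff_vectorSpace_iff_contDiff.2 contDiff_const
    refine (h1.comp h2.contMDiffOn (s := e.target) fun u hu ↦ hu).congr fun u hu ↦ ?_
    simp only [Function.comp, tangentMapWithin, mfderivWithin_of_isOpen e.open_target hu]
    rfl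
  refine contDiffOn_clm_apply.2 fun a ↦ contDiffOn_clm_apply.2 fun b ↦ ?_
  exact contMDiffOn_iff_contDiffOn.1 (ContMDiffOn.inner_bundle (F := E) (IB := 𝓘(ℝ, E))
    (E := fun x : X ↦ TangentSpace 𝓘(ℝ, E) x) (b := e.symm)
    (v := fun u ↦ symmDeriv e u a) (w := fun u ↦ symmDeriv e u b) (hsec a) (hsec b))

lemma contDiffOn_gradient
    (he : e ∈ IsManifold.maximalAtlas 𝓘(ℝ, E) ∞ X) {f : X → ℝ} {O : Set X} (hO : IsOpen O)
    (hf : ContMDiffOn 𝓘(ℝ, E) 𝓘(ℝ, ℝ) ∞ f O) :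
    ContDiffOn ℝ ∞ (fieldInChart e (gradient f)) (e.target ∩ e.symm ⁻¹' O) := by
  have hopen : IsOpen (e.target ∩ e.symm ⁻¹' O) := e.isOpen_inter_preimage_symm hO
  have hfe : ContDiffOn ℝ ∞ (fun y ↦ f (e.symm y)) (e.target ∩ e.symm ⁻¹' O) :=
    contMDiffOn_iff_contDiffOn.1 (hf.comp ((contMDiffOn_symm_of_mem_maximalAtlas he).mono
      inter_subset_left) fun u hu ↦ hu.2)
  have hinv := contDiffOn_inverse_of_posDef
    ((contDiffOn_metricInChart he).mono (inter_subset_left (t := e.symm ⁻¹' O)))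
    fun q hq ↦ metricInChart_pos he hq.1
  refine (hinv.clm_apply (hfe.fderiv_of_isOpen hopen (m := ∞) (by simp))).congr fun u hu ↦ ?_
  have hfu : MDifferentiableAt 𝓘(ℝ, E) 𝓘(ℝ, ℝ) f (e.symm u) :=
    (hf.contMDiffAt (hO.mem_nhds hu.2)).mdifferentiableAt (by simp)
  rw [← metricInChart_gradient he hu.1 hfu, inverse_apply_of_posDef (metricInChart_pos he hu.1)]

end Metric

/-! ### Independence of the covariant derivative of the chart -/

section CovariantDerivative

set_option maxSynthPendingDepth 5

variable {E : Type*} [NormedAddCommGroup E] [NormedSpace ℝ E]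

/-- The covariant derivative of the vector field `Y` along `a`, paired with `b`, for the metric `g`
on a vector space: `g(∂_a Y, b) + ½ (∂_a g(Y, b) + ∂_Y g(a, b) - ∂_b g(a, Y))`. -/
noncomputable def covariantForm (g : E → E →L[ℝ] E →L[ℝ] ℝ) (Y : E → E) (u a b : E) : ℝ :=
  g u (fderiv ℝ Y u a) b + (1 / 2) *
    (fderiv ℝ g u a (Y u) b + fderiv ℝ g u (Y u) a b - fderiv ℝ g u b a (Y u))

/-- The pairing `g(∇_a Y, b)` is invariant under a change of variables `ψ`: the terms containing the
second derivative of `ψ` cancel. -/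
lemma covariantForm_transform {g g' : E → E →L[ℝ] E →L[ℝ] ℝ} {Y Y' : E → E} {ψ : E → E} {u : E}
    (hψ : ContDiffAt ℝ ∞ ψ u) (hgd : DifferentiableAt ℝ g u) (hgd' : DifferentiableAt ℝ g' (ψ u))
    (hYd : DifferentiableAt ℝ Y u) (hYd' : DifferentiableAt ℝ Y' (ψ u))
    (hsymm : ∀ a b, g' (ψ u) a b = g' (ψ u) b a)
    (hg : ∀ᶠ y in 𝓝 u, ∀ a b, g y a b = g' (ψ y) (fderiv ℝ ψ y a) (fderiv ℝ ψ y b))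
    (hY : ∀ᶠ y in 𝓝 u, Y' (ψ y) = fderiv ℝ ψ y (Y y)) (a b : E) :
    covariantForm g Y u a b =
      covariantForm g' Y' (ψ u) (fderiv ℝ ψ u a) (fderiv ℝ ψ u b) := by
  have hψ1 : HasFDerivAt ψ (fderiv ℝ ψ u) u := (hψ.differentiableAt (by simp)).hasFDerivAt
  have hψ2 : HasFDerivAt (fderiv ℝ ψ) (fderiv ℝ (fderiv ℝ ψ) u) u :=
    ((hψ.fderiv_right (m := ∞) (by simp)).differentiableAt (by simp)).hasFDerivAt
  have hs : ∀ a b, fderiv ℝ (fderiv ℝ ψ) u a b = fderiv ℝ (fderiv ℝ ψ) u b a := fun a b ↦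
    (hψ.isSymmSndFDerivAt (by simpa using ENat.LEInfty.out)).eq a b
  have hDY : fderiv ℝ Y' (ψ u) (fderiv ℝ ψ u a) =
      fderiv ℝ ψ u (fderiv ℝ Y u a) + fderiv ℝ (fderiv ℝ ψ) u a (Y u) := by
    have h1 := hYd'.hasFDerivAt.comp u hψ1
    have h2 := (hψ2.clm_apply hYd.hasFDerivAt).congr_of_eventuallyEq (f₁ := Y' ∘ ψ) hY
    simpa using DFunLike.congr_fun (h1.unique h2) a
  have hDg : ∀ c a b, fderiv ℝ g u c a b =
      fderiv ℝ g' (ψ u) (fderiv ℝ ψ u c) (fderiv ℝ ψ u a) (fderiv ℝ ψ u b) +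
        g' (ψ u) (fderiv ℝ (fderiv ℝ ψ) u c a) (fderiv ℝ ψ u b) +
        g' (ψ u) (fderiv ℝ ψ u a) (fderiv ℝ (fderiv ℝ ψ) u c b) := by
    intro c a b
    have h1 := (hgd.hasFDerivAt.clm_apply (hasFDerivAt_const a u)).clm_apply (hasFDerivAt_const b u)
    have ha := hψ2.clm_apply (hasFDerivAt_const a u)
    have hb := hψ2.clm_apply (hasFDerivAt_const b u)
    have h2 := (((hgd'.hasFDerivAt.comp u hψ1).clm_apply ha).clm_apply hb).congr_of_eventuallyEq
      (f₁ := fun y ↦ g y a b) (by filter_upwards [hg] with y hy using hy a b)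
    have h3 := DFunLike.congr_fun (h1.unique h2) c
    simp at h3
    rw [h3]
    ring
  have hYu := hY.self_of_nhds
  have hgu := hg.self_of_nhds
  simp only [covariantForm, hYu, hDY, hDg, hgu, map_add, add_apply]
  rw [hs (Y u) a, hs b a, hs b (Y u),
    hsymm (fderiv ℝ ψ u (Y u)) (fderiv ℝ (fderiv ℝ ψ) u a b)]
  ring

variable {X : Type*} [EMetricSpace X] [ChartedSpace E X] {e e' : OpenPartialHomeomorph X E}

lemma chartDeriv_inverse (he : e ∈ IsManifold.maximalAtlas 𝓘(ℝ, E) ∞ X) {u : E}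
    (hu : u ∈ e.target) : (chartDeriv e (e.symm u)).inverse = symmDeriv e u :=
  ContinuousLinearMap.inverse_eq (ContinuousLinearMap.ext fun v ↦ chartDeriv_symmDeriv he hu v)
    (ContinuousLinearMap.ext fun v ↦ symmDeriv_chartDeriv he hu v)

variable [FiniteDimensional ℝ E] [RiemannianBundle (fun x : X ↦ TangentSpace 𝓘(ℝ, E) x)]

/-- The Levi-Civita connection computed in an arbitrary chart. -/
noncomputable def leviCivitaIn (e : OpenPartialHomeomorph X E)
    (Y : ∀ x : X, TangentSpace 𝓘(ℝ, E) x) (x : X) (v : TangentSpace 𝓘(ℝ, E) x) :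
    TangentSpace 𝓘(ℝ, E) x :=
  haveI := FiniteDimensional.complete ℝ (TangentSpace 𝓘(ℝ, E) x)
  (chartDeriv e x).inverse (fderiv ℝ (fieldInChart e Y) (e x) (chartDeriv e x v)) +
    (InnerProductSpace.toDual ℝ (TangentSpace 𝓘(ℝ, E) x)).symm
      ((christoffel e (e x) (chartDeriv e x v) (chartDeriv e x (Y x))).comp (chartDeriv e x))

lemma leviCivita_eq (Y : ∀ x : X, TangentSpace 𝓘(ℝ, E) x) (x : X)
    (v : TangentSpace 𝓘(ℝ, E) x) : leviCivita Y x v = leviCivitaIn (chartAt E x) Y x v := rfl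

lemma inner_leviCivitaIn (he : e ∈ IsManifold.maximalAtlas 𝓘(ℝ, E) ∞ X) {x : X}
    (hx : x ∈ e.source) (Y : ∀ x : X, TangentSpace 𝓘(ℝ, E) x) (v w : TangentSpace 𝓘(ℝ, E) x) :
    inner ℝ (leviCivitaIn e Y x v) w = covariantForm (metricInChart e) (fieldInChart e Y) (e x)
      (chartDeriv e x v) (chartDeriv e x w) := by
  have := FiniteDimensional.complete ℝ (TangentSpace 𝓘(ℝ, E) x)
  obtain ⟨u, hu, rfl⟩ : ∃ u ∈ e.target, x = e.symm u :=
    ⟨e x, e.map_source hx, (e.left_inv hx).symm⟩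
  rw [leviCivitaIn, inner_add_left, InnerProductSpace.toDual_symm_apply, chartDeriv_inverse he hu,
    e.right_inv hu, covariantForm]
  congr 1
  · rw [metricInChart_apply, symmDeriv_chartDeriv he hu]

variable [IsManifold 𝓘(ℝ, E) ∞ X]
  [IsContMDiffRiemannianBundle 𝓘(ℝ, E) ∞ E (fun x : X ↦ TangentSpace 𝓘(ℝ, E) x)]

/-- The Hessian may be computed in any chart of the maximal atlas. -/
lemma hessian_eq_leviCivitaIn (he : e ∈ IsManifold.maximalAtlas 𝓘(ℝ, E) ∞ X) {x : X}
    (hx : x ∈ e.source) {f : X → ℝ} {O : Set X} (hO : IsOpen O) (hxO : x ∈ O)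
    (hf : ContMDiffOn 𝓘(ℝ, E) 𝓘(ℝ, ℝ) ∞ f O) (v : TangentSpace 𝓘(ℝ, E) x) :
    hessian f x v = leviCivitaIn e (gradient f) x v := by
  rw [hessian, leviCivita_eq]
  set e' := chartAt E x
  have he' : e' ∈ IsManifold.maximalAtlas 𝓘(ℝ, E) ∞ X := IsManifold.chart_mem_maximalAtlas x
  have hx' : x ∈ e'.source := mem_chart_source E x
  refine ext_inner_right ℝ fun w ↦ ?_
  rw [inner_leviCivitaIn he hx, inner_leviCivitaIn he' hx']
  obtain ⟨u, hu, rfl⟩ : ∃ u ∈ e.target, x = e.symm u :=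
    ⟨e x, e.map_source hx, (e.left_inv hx).symm⟩
  rw [e.right_inv hu]
  let ψ : E → E := fun y ↦ e' (e.symm y)
  have hψ : ContDiffAt ℝ ∞ ψ u := contDiffAt_transition he he' hu hx'
  have hnear : ∀ᶠ y in 𝓝 u, y ∈ e.target ∧ e.symm y ∈ e'.source :=
    (e.isOpen_inter_preimage_symm e'.open_source).mem_nhds ⟨hu, hx'⟩
  have hψ' : ∀ y ∈ e.target, e.symm y ∈ e'.source →
      fderiv ℝ ψ y = (chartDeriv e' (e.symm y)).comp (symmDeriv e y) := fun y hy hy' ↦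
    (hasFDerivAt_transition he he' hy hy').fderiv
  have hback : ∀ v, chartDeriv e' (e.symm u) v = fderiv ℝ ψ u (chartDeriv e (e.symm u) v) := by
    intro v
    rw [hψ' u hu hx', ContinuousLinearMap.comp_apply, symmDeriv_chartDeriv he hu]
  have hdiff : ∀ {ε : OpenPartialHomeomorph X E}, ε ∈ IsManifold.maximalAtlas 𝓘(ℝ, E) ∞ X →
      e.symm u ∈ ε.source → DifferentiableAt ℝ (metricInChart ε) (ε (e.symm u)) ∧
        DifferentiableAt ℝ (fieldInChart ε (gradient f)) (ε (e.symm u)) := by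
    intro ε hε hxε
    have hmem := ε.map_source hxε
    have h2 : ε (e.symm u) ∈ ε.target ∩ ε.symm ⁻¹' O := ⟨hmem, by
      rw [mem_preimage, ε.left_inv hxε]
      exact hxO⟩
    exact ⟨((contDiffOn_metricInChart hε).contDiffAt
        (ε.open_target.mem_nhds hmem)).differentiableAt (by simp),
      ((contDiffOn_gradient hε hO hf).contDiffAt
        ((ε.isOpen_inter_preimage_symm hO).mem_nhds h2)).differentiableAt (by simp)⟩
  have hd := hdiff he hx
  rw [e.right_inv hu] at hd
  have hd' := hdiff he' hx'
  rw [hback v, hback w]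
  refine (covariantForm_transform hψ hd.1 hd'.1 hd.2 hd'.2
    (fun a b ↦ metricInChart_symm e' _ a b) ?_ ?_ _ _).symm
  · filter_upwards [hnear] with y hy a b
    rw [hψ' y hy.1 hy.2]
    exact (metricInChart_chartDeriv he' hy.2 _ _).symm
  · filter_upwards [hnear] with y hy
    rw [hψ' y hy.1 hy.2, ContinuousLinearMap.comp_apply, fieldInChart_apply e,
      symmDeriv_chartDeriv he hy.1, fieldInChart_apply e', e'.left_inv hy.2]

end CovariantDerivative

/-! ### Slice charts of a submanifold -/

section Slice

set_option maxSynthPendingDepth 5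

universe u

variable {E : Type u} [NormedAddCommGroup E] [NormedSpace ℝ E] [FiniteDimensional ℝ E]
  {X : Type*} [TopologicalSpace X] [ChartedSpace E X]
  {F : Type*} [NormedAddCommGroup F] [NormedSpace ℝ F]
  {M : Type*} [TopologicalSpace M] [ChartedSpace F M]

/-- Around a point of an embedded submanifold there is a chart in which the submanifold is the
linear slice `J (F × 0)`. -/
lemma exists_slice_chart {ι : M → X} (hι : IsSmoothEmbedding 𝓘(ℝ, F) 𝓘(ℝ, E) ∞ ι) (m : M) :
    ∃ e ∈ IsManifold.maximalAtlas 𝓘(ℝ, E) ∞ X,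
      ∃ (C : Type u) (_ : NormedAddCommGroup C) (_ : NormedSpace ℝ C)
        (_ : FiniteDimensional ℝ C) (J : (F × C) ≃L[ℝ] E) (s₀ : F) (W : Set E),
        ι m ∈ e.source ∧ e (ι m) = J (s₀, 0) ∧ IsOpen W ∧ W ⊆ e.target ∧ J (s₀, 0) ∈ W ∧
        (∀ u ∈ W, e.symm u ∈ range ι ↔ ∃ s, u = J (s, 0)) ∧
        ∀ v : TangentSpace 𝓘(ℝ, E) (ι m),
          v ∈ (mfderiv 𝓘(ℝ, F) 𝓘(ℝ, E) ι m).range ↔ ∃ a, chartDeriv e (ι m) v = J (a, 0) := by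
  have h := hι.isImmersion.isImmersionAt m
  set d := h.domChart
  set e := h.codChart
  have hd := h.domChart_mem_maximalAtlas
  have he := h.codChart_mem_maximalAtlas
  have hfin : FiniteDimensional ℝ (F × h.complement) :=
    LinearEquiv.finiteDimensional h.equiv.symm.toLinearEquiv
  have hC : FiniteDimensional ℝ h.complement :=
    Module.Finite.of_surjective (LinearMap.snd ℝ F h.complement) LinearMap.snd_surjective
  have hw : ∀ s ∈ d.target, e (ι (d.symm s)) = h.equiv (s, 0) := by
    intro s hs
    have hs' : s ∈ (d.extend 𝓘(ℝ, F)).target := by simpa using hs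
    simpa using h.writtenInCharts hs'
  have hm : m ∈ d.source := h.mem_domChart_source
  have hx : ι m ∈ e.source := h.mem_codChart_source
  have hw' : ∀ m' ∈ d.source, e (ι m') = h.equiv (d m', 0) := by
    intro m' hm'
    have := hw (d m') (d.map_source hm')
    rwa [d.left_inv hm'] at this
  obtain ⟨O, hO, hOd⟩ := (hι.isEmbedding.isOpen_iff).1 d.open_source
  let W : Set E := (e.target ∩ e.symm ⁻¹' O) ∩ (fun u ↦ (h.equiv.symm u).1) ⁻¹' d.target
  refine ⟨e, he, h.complement, inferInstance, inferInstance, hC, h.equiv, d m, W, hx,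
    hw' m hm, ?_, fun u hu ↦ hu.1.1, ?_, fun u hu ↦ ⟨?_, ?_⟩, fun v ↦ ?_⟩
  · exact (e.isOpen_inter_preimage_symm hO).inter (d.open_target.preimage
      (continuous_fst.comp h.equiv.symm.continuous))
  · rw [← hw' m hm]
    refine ⟨⟨e.map_source hx, ?_⟩, ?_⟩
    · rw [mem_preimage, e.left_inv hx]
      change m ∈ ι ⁻¹' O
      rw [hOd]
      exact hm
    · rw [mem_preimage, hw' m hm]
      simpa using d.map_source hm
  · rintro ⟨m', hm'⟩
    have hm'd : m' ∈ d.source := by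
      rw [← hOd, mem_preimage, hm']
      exact hu.1.2
    refine ⟨d m', ?_⟩
    rw [← hw' m' hm'd, hm', e.right_inv hu.1.1]
  · rintro ⟨s, rfl⟩
    have hs : s ∈ d.target := by simpa using hu.2
    refine ⟨d.symm s, ?_⟩
    rw [← hw s hs, e.left_inv]
    exact h.source_subset_preimage_source (d.map_target hs)
  · -- differentiate `e ∘ ι = J (d ·, 0)` at `m`
    have hdm : MDifferentiableAt 𝓘(ℝ, F) 𝓘(ℝ, F) d m :=
      (mdifferentiable_of_mem_maximalAtlas hd).mdifferentiableAt hm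
    have hem : MDifferentiableAt 𝓘(ℝ, E) 𝓘(ℝ, E) e (ι m) :=
      (mdifferentiable_of_mem_maximalAtlas he).mdifferentiableAt hx
    have hιm : MDifferentiableAt 𝓘(ℝ, F) 𝓘(ℝ, E) ι m := (hι.contMDiff m).mdifferentiableAt (by simp)
    let S : F →L[ℝ] E := (h.equiv : F × h.complement →L[ℝ] E).comp
      (ContinuousLinearMap.inl ℝ F h.complement)
    have h1 := hem.hasMFDerivAt.comp m hιm.hasMFDerivAt
    have h2 : HasMFDerivAt 𝓘(ℝ, F) 𝓘(ℝ, E) (S ∘ d) m (S.comp (chartDeriv d m)) :=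
      S.hasMFDerivAt.comp m hdm.hasMFDerivAt
    have h3 : (e ∘ ι) =ᶠ[𝓝 m] S ∘ d := by
      filter_upwards [d.open_source.mem_nhds hm] with m' hm'
      exact hw' m' hm'
    have h4 : ∀ w : TangentSpace 𝓘(ℝ, F) m,
        chartDeriv e (ι m) (mfderiv 𝓘(ℝ, F) 𝓘(ℝ, E) ι m w) = h.equiv (chartDeriv d m w, 0) :=
      fun w ↦ DFunLike.congr_fun (hasMFDerivAt_unique h1 (h2.congr_of_eventuallyEq h3)) w
    constructor
    · rintro ⟨w, rfl⟩
      exact ⟨chartDeriv d m w, h4 w⟩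
    · rintro ⟨a, ha⟩
      obtain ⟨w, rfl⟩ := (mdifferentiable_of_mem_maximalAtlas hd).mfderiv_surjective hm a
      refine ⟨w, ?_⟩
      refine (mdifferentiable_of_mem_maximalAtlas he).mfderiv_injective hx ?_
      exact (h4 w).trans ha.symm

end Slice

/-! ### Lengths of curves and the distance to the submanifold -/

section Length

set_option maxSynthPendingDepth 5

open MeasureTheory

variable {E : Type*} [NormedAddCommGroup E] [NormedSpace ℝ E]
  {X : Type*} [EMetricSpace X] [ChartedSpace E X]
  [RiemannianBundle (fun x : X ↦ TangentSpace 𝓘(ℝ, E) x)]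
  {e : OpenPartialHomeomorph X E}

/-- A curve of constant speed `c` in a chart bounds the Riemannian distance of its endpoints. -/
lemma riemannianEDist_le_of_const_speed (he : e ∈ IsManifold.maximalAtlas 𝓘(ℝ, E) ∞ X)
    {q : ℝ → E} {c : ℝ} (hq : ContDiffOn ℝ 1 q (Icc 0 1))
    (hqe : ∀ t ∈ Icc (0 : ℝ) 1, q t ∈ e.target)
    (hspeed : ∀ t ∈ Icc (0 : ℝ) 1, ∃ v, HasDerivWithinAt q v (Icc 0 1) t ∧
      metricInChart e (q t) v v = c ^ 2) (hc : 0 ≤ c) :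
    riemannianEDist 𝓘(ℝ, E) (e.symm (q 0)) (e.symm (q 1)) ≤ ENNReal.ofReal c := by
  have hγ : ContMDiffOn 𝓘(ℝ, ℝ) 𝓘(ℝ, E) 1 (fun t ↦ e.symm (q t)) (Icc 0 1) :=
    ((contMDiffOn_symm_of_mem_maximalAtlas he).of_le (by simp)).comp
      (contMDiffOn_iff_contDiffOn.2 hq) hqe
  refine (riemannianEDist_le_pathELength hγ rfl rfl zero_le_one).trans ?_
  rw [pathELength_eq_lintegral_mfderivWithin_Icc]
  have key : ∀ t ∈ Icc (0 : ℝ) 1,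
      ‖mfderivWithin 𝓘(ℝ, ℝ) 𝓘(ℝ, E) (fun t ↦ e.symm (q t)) (Icc 0 1) t 1‖ₑ = ENNReal.ofReal c := by
    intro t ht
    obtain ⟨v, hv, hvc⟩ := hspeed t ht
    have h1 := ((mdifferentiable_of_mem_maximalAtlas he).mdifferentiableAt_symm
      (hqe t ht)).hasMFDerivAt.comp_hasMFDerivWithinAt t hv.hasFDerivWithinAt.hasMFDerivWithinAt
    have h2 : mfderivWithin 𝓘(ℝ, ℝ) 𝓘(ℝ, E) (fun t ↦ e.symm (q t)) (Icc 0 1) t 1 =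
        symmDeriv e (q t) v := by
      have h3 := h1.mfderivWithin ((uniqueDiffOn_Icc_zero_one t ht).uniqueMDiffWithinAt)
      refine (DFunLike.congr_fun h3 (1 : ℝ)).trans ?_
      change symmDeriv e (q t) ((1 : ℝ) • v) = _
      rw [one_smul]
    have h4 : ‖symmDeriv e (q t) v‖ = c := by
      rw [metricInChart_apply, real_inner_self_eq_norm_sq] at hvc
      exact (pow_left_inj₀ (norm_nonneg _) hc two_ne_zero).1 hvc
    refine (congrArg (fun w : TangentSpace 𝓘(ℝ, E) (e.symm (q t)) ↦ ‖w‖ₑ) h2).trans ?_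
    rw [← ofReal_norm, h4]
  rw [setLIntegral_congr_fun measurableSet_Icc key]
  simp

/-- If `|∇f|² = 2f` then `√(2f)` is `1`-Lipschitz: here along a curve that ends at a zero of `f`.
As `√(2f)` need not be differentiable at the zeros, it is approximated by `√(2f + δ²)`. -/
lemma ofReal_sqrt_le_pathELength (he : e ∈ IsManifold.maximalAtlas 𝓘(ℝ, E) ∞ X)
    {U : Set E} (hU : IsOpen U) {f : E → ℝ} (hf : ContDiffOn ℝ 1 f U)
    (hgrad : ∀ u ∈ U, ∃ v, metricInChart e u v = fderiv ℝ f u ∧ metricInChart e u v v = 2 * f u)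
    {γ : ℝ → X} (hγ : ContMDiffOn 𝓘(ℝ, ℝ) 𝓘(ℝ, E) 1 γ (Icc 0 1))
    (hγe : ∀ t ∈ Icc (0 : ℝ) 1, γ t ∈ e.source) (hγU : ∀ t ∈ Icc (0 : ℝ) 1, e (γ t) ∈ U)
    (h1 : f (e (γ 1)) = 0) :
    ENNReal.ofReal (√(2 * f (e (γ 0)))) ≤ pathELength 𝓘(ℝ, E) γ 0 1 := by
  have hf0 : ∀ u ∈ U, 0 ≤ f u := by
    intro u hu
    obtain ⟨v, -, hv⟩ := hgrad u hu
    rw [metricInChart_apply] at hv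
    have : (0 : ℝ) ≤ inner ℝ (symmDeriv e u v) (symmDeriv e u v) := real_inner_self_nonneg
    linarith
  have hq : ContDiffOn ℝ 1 (fun t ↦ e (γ t)) (Icc 0 1) := contMDiffOn_iff_contDiffOn.1
    (((contMDiffOn_of_mem_maximalAtlas he).of_le (by simp)).comp hγ hγe)
  have hfq : ContDiffOn ℝ 1 (fun t ↦ f (e (γ t))) (Icc 0 1) := hf.comp hq hγU
  have hderiv : ∀ t ∈ Icc (0 : ℝ) 1,
      |derivWithin (fun t ↦ f (e (γ t))) (Icc 0 1) t| ≤ √(2 * f (e (γ t))) *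
        ‖mfderivWithin 𝓘(ℝ, ℝ) 𝓘(ℝ, E) γ (Icc 0 1) t 1‖ := by
    intro t ht
    set w : TangentSpace 𝓘(ℝ, E) (γ t) := mfderivWithin 𝓘(ℝ, ℝ) 𝓘(ℝ, E) γ (Icc 0 1) t 1
    have hd1 := ((mdifferentiable_of_mem_maximalAtlas he).mdifferentiableAt
      (hγe t ht)).hasMFDerivAt.comp_hasMFDerivWithinAt t
        ((hγ t ht).mdifferentiableWithinAt one_ne_zero).hasMFDerivWithinAt
    have hd2 : HasFDerivWithinAt (fun t ↦ e (γ t)) _ (Icc 0 1) t := hd1.hasFDerivWithinAt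
    have hfd : HasFDerivAt f (fderiv ℝ f (e (γ t))) (e (γ t)) :=
      ((hf.contDiffAt (hU.mem_nhds (hγU t ht))).differentiableAt one_ne_zero).hasFDerivAt
    have hd3 := (hfd.comp_hasFDerivWithinAt t hd2).hasDerivWithinAt.derivWithin
      (uniqueDiffOn_Icc_zero_one t ht)
    have hd4 : derivWithin (fun t ↦ f (e (γ t))) (Icc 0 1) t =
        fderiv ℝ f (e (γ t)) (chartDeriv e (γ t) w) := hd3
    obtain ⟨v, hv, hvv⟩ := hgrad _ (hγU t ht)
    obtain ⟨z, rfl⟩ : ∃ z : TangentSpace 𝓘(ℝ, E) (γ t), v = chartDeriv e (γ t) z := by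
      obtain ⟨z, hz⟩ := (mdifferentiable_of_mem_maximalAtlas he).mfderiv_surjective (hγe t ht) v
      exact ⟨z, hz.symm⟩
    rw [metricInChart_chartDeriv he (hγe t ht), real_inner_self_eq_norm_sq] at hvv
    rw [hd4, ← hv, metricInChart_chartDeriv he (hγe t ht), ← hvv, Real.sqrt_sq (norm_nonneg _)]
    exact abs_real_inner_le_norm _ _
  have hδ : ∀ δ : ℝ, 0 < δ →
      ENNReal.ofReal (√(2 * f (e (γ 0)))) ≤ pathELength 𝓘(ℝ, E) γ 0 1 + ENNReal.ofReal δ := by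
    intro δ hδ
    let h : ℝ → ℝ := fun t ↦ √(2 * f (e (γ t)) + δ ^ 2)
    have hpos : ∀ t ∈ Icc (0 : ℝ) 1, 0 < 2 * f (e (γ t)) + δ ^ 2 := fun t ht ↦ by
      have := hf0 _ (hγU t ht)
      positivity
    have hh : ContDiffOn ℝ 1 h (Icc 0 1) :=
      ((contDiffOn_const.mul hfq).add contDiffOn_const).sqrt fun t ht ↦ (hpos t ht).ne'
    have hle : ∀ t ∈ Icc (0 : ℝ) 1, ‖derivWithin h (Icc 0 1) t‖ₑ ≤
        ‖mfderivWithin 𝓘(ℝ, ℝ) 𝓘(ℝ, E) γ (Icc 0 1) t 1‖ₑ := by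
      intro t ht
      have hd := (hfq.differentiableOn one_ne_zero t ht).hasDerivWithinAt
      have hd' := (((hd.const_mul 2).add_const (δ ^ 2)).sqrt (hpos t ht).ne').derivWithin
        (uniqueDiffOn_Icc_zero_one t ht)
      have hs : 0 < √(2 * f (e (γ t)) + δ ^ 2) := Real.sqrt_pos.2 (hpos t ht)
      have hreal : ‖derivWithin h (Icc 0 1) t‖ ≤
          ‖mfderivWithin 𝓘(ℝ, ℝ) 𝓘(ℝ, E) γ (Icc 0 1) t 1‖ := by
        refine (congrArg norm hd').le.trans ?_
        rw [Real.norm_eq_abs, abs_div, abs_of_pos (mul_pos two_pos hs), abs_mul, abs_two,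
          mul_div_mul_left _ _ two_ne_zero, div_le_iff₀ hs, mul_comm]
        refine (hderiv t ht).trans (mul_le_mul_of_nonneg_right ?_ (norm_nonneg _))
        exact Real.sqrt_le_sqrt (by linarith [sq_nonneg δ])
      rw [← ofReal_norm, ← ofReal_norm]
      exact ENNReal.ofReal_le_ofReal hreal
    have hint := enorm_sub_le_lintegral_derivWithin_Icc_of_contDiffOn_Icc hh zero_le_one
    have hint2 : ‖h 1 - h 0‖ₑ ≤ pathELength 𝓘(ℝ, E) γ 0 1 := by
      rw [pathELength_eq_lintegral_mfderivWithin_Icc]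
      exact hint.trans (setLIntegral_mono' measurableSet_Icc hle)
    have hh1 : h 1 = δ := by
      simp only [h, h1, mul_zero, zero_add]
      exact Real.sqrt_sq hδ.le
    have hh0 : √(2 * f (e (γ 0))) ≤ h 0 := Real.sqrt_le_sqrt (by linarith [sq_nonneg δ])
    have hfin : √(2 * f (e (γ 0))) ≤ ‖h 1 - h 0‖ + δ := by
      rw [hh1, Real.norm_eq_abs, abs_sub_comm]
      linarith [le_abs_self (h 0 - δ)]
    refine (ENNReal.ofReal_le_ofReal hfin).trans ?_
    rw [ENNReal.ofReal_add (norm_nonneg _) hδ.le, ofReal_norm]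
    gcongr
  refine ENNReal.le_of_forall_pos_le_add fun ε hε _ ↦ ?_
  simpa using hδ ε (by exact_mod_cast hε)

end Length

section Distance

set_option maxSynthPendingDepth 5

universe u

variable {E : Type u} [NormedAddCommGroup E] [NormedSpace ℝ E] [FiniteDimensional ℝ E]
  {X : Type*} [EMetricSpace X] [ChartedSpace E X] [IsManifold 𝓘(ℝ, E) ∞ X]
  [RiemannianBundle (fun x : X ↦ TangentSpace 𝓘(ℝ, E) x)]
  [IsContMDiffRiemannianBundle 𝓘(ℝ, E) ∞ E (fun x : X ↦ TangentSpace 𝓘(ℝ, E) x)]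
  [IsRiemannianManifold 𝓘(ℝ, E) X]
  {F : Type*} [NormedAddCommGroup F] [NormedSpace ℝ F] [FiniteDimensional ℝ F]
  {M : Type*} [TopologicalSpace M] [ChartedSpace F M]

/-- In a slice chart, half the squared distance to the submanifold is the solution `f` of the
eikonal equation. The normal geodesics show that the distance is at most `√(2f)`; conversely a curve
to the submanifold that is shorter than the radius stays in the chart, and its length is at least
`√(2f)` because this function is `1`-Lipschitz. -/
theorem exists_halfSqDist_eq {ι : M → X} (hι : IsSmoothEmbedding 𝓘(ℝ, F) 𝓘(ℝ, E) ∞ ι) (m : M) :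
    ∃ e ∈ IsManifold.maximalAtlas 𝓘(ℝ, E) ∞ X, ι m ∈ e.source ∧ ∃ O : Set X, IsOpen O ∧ ι m ∈ O ∧
      O ⊆ e.source ∧ ∃ f : E → ℝ, (∀ x ∈ O, halfSqDist (range ι) x = f (e x)) ∧
        (∀ x ∈ O, ContDiffAt ℝ ∞ f (e x)) ∧ fderiv ℝ f (e (ι m)) = 0 ∧
        (∀ v ∈ tangentOf (F := F) ι m,
          fderiv ℝ (fderiv ℝ f) (e (ι m)) (chartDeriv e (ι m) v) = 0) ∧
        ∀ v ∈ (tangentOf (F := F) ι m)ᗮ, ∀ w,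
          fderiv ℝ (fderiv ℝ f) (e (ι m)) (chartDeriv e (ι m) v) (chartDeriv e (ι m) w) =
            inner ℝ v w := by
  obtain ⟨e, he, C, _, _, _, J, s₀, W, hx, hu₀, hW, hWe, hu₀W, hslice, htan⟩ :=
    exists_slice_chart hι m
  have hposW : ∀ q ∈ W, ∀ a, a ≠ 0 → 0 < metricInChart e q a a := fun q hq a ha ↦
    metricInChart_pos he (hWe hq) a ha
  obtain ⟨U, hUW, hU, hu₀U, f, hf, hfz, hgrad, hcurve, hT, hN⟩ := exists_eikonal J hW
    ((contDiffOn_metricInChart he).mono hWe) (fun q _ a b ↦ metricInChart_symm e q a b) hposW hu₀W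
  have hf0 : ∀ u ∈ U, 0 ≤ f u := by
    intro u hu
    obtain ⟨v, -, hv⟩ := hgrad u hu
    rw [metricInChart_apply] at hv
    have : (0 : ℝ) ≤ inner ℝ (symmDeriv e u v) (symmDeriv e u v) := real_inner_self_nonneg
    linarith
  -- a metric ball whose double is covered by the domain of the eikonal function
  have hOU : IsOpen (e.source ∩ e ⁻¹' U) := e.isOpen_inter_preimage hU
  obtain ⟨r, hr, hball⟩ := EMetric.mem_nhds_iff.1 (hOU.mem_nhds
    (show ι m ∈ e.source ∩ e ⁻¹' U from ⟨hx, by rwa [mem_preimage, hu₀]⟩))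
  have hr2 : r / 2 ≠ 0 := by simpa using hr.ne'
  have hballsub : ∀ x ∈ Metric.eball (ι m) (r / 2), x ∈ e.source ∩ e ⁻¹' U := fun x hx ↦
    hball (Metric.eball_subset_eball ENNReal.half_le_self hx)
  have hdist : ∀ x ∈ Metric.eball (ι m) (r / 2),
      Metric.infEDist x (range ι) = ENNReal.ofReal (√(2 * f (e x))) := by
    intro x hxr
    obtain ⟨hxs, hxU⟩ := hballsub x hxr
    refine le_antisymm ?_ (le_of_not_gt fun hlt ↦ ?_)
    · obtain ⟨q, s, hq0, hq1, hq, hqv⟩ := hcurve (e x) hxU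
      have hs : e.symm (q 0) ∈ range ι := (hslice _
        (hqv 0 (left_mem_Icc.2 zero_le_one)).1).2 ⟨s, hq0⟩
      have h1 := riemannianEDist_le_of_const_speed he (q := q) (c := √(2 * f (e x))) hq
        (fun t ht ↦ hWe (hqv t ht).1) (fun t ht ↦ by
          rw [Real.sq_sqrt (mul_nonneg two_pos.le (hf0 _ hxU))]
          exact (hqv t ht).2) (Real.sqrt_nonneg _)
      rw [hq1, e.left_inv hxs, ← IsRiemannianManifold.out, edist_comm] at h1
      exact (Metric.infEDist_le_edist_of_mem hs).trans h1
    · -- a nearly shortest curve to the submanifold does not leave the double ball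
      have hlt' : Metric.infEDist x (range ι) < min (ENNReal.ofReal (√(2 * f (e x)))) (r / 2) :=
        lt_min hlt ((Metric.infEDist_le_edist_of_mem (mem_range_self m)).trans_lt hxr)
      obtain ⟨y, hy, hxy⟩ := Metric.infEDist_lt_iff.1 hlt'
      rw [IsRiemannianManifold.out (I := 𝓘(ℝ, E)) x y] at hxy
      obtain ⟨γ, hγ0, hγ1, hγ, hlen⟩ := exists_lt_of_riemannianEDist_lt hxy
      have hmem : ∀ t ∈ Icc (0 : ℝ) 1, γ t ∈ e.source ∩ e ⁻¹' U := by
        intro t ht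
        refine hball ?_
        have h1 : edist x (γ t) ≤ pathELength 𝓘(ℝ, E) γ 0 1 := by
          rw [IsRiemannianManifold.out (I := 𝓘(ℝ, E)) x (γ t)]
          exact (riemannianEDist_le_pathELength (hγ.mono (Icc_subset_Icc_right ht.2)) hγ0 rfl
            ht.1).trans (pathELength_mono le_rfl ht.2)
        have h2 : edist (γ t) (ι m) < r / 2 + r / 2 := by
          refine (edist_triangle_left (γ t) (ι m) x).trans_lt ?_
          exact ENNReal.add_lt_add (h1.trans_lt (hlen.trans_le (min_le_right _ _))) hxr
        rwa [ENNReal.add_halves] at h2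
      have hy' := hmem 1 (right_mem_Icc.2 zero_le_one)
      have hfy : f (e (γ 1)) = 0 := by
        obtain ⟨s, hs⟩ := (hslice _ (hUW hy'.2)).1 (by rw [e.left_inv hy'.1, hγ1]; exact hy)
        rw [hs]
        exact hfz s (by rw [← hs]; exact hy'.2)
      have h3 := ofReal_sqrt_le_pathELength he hU (hf.of_le (by simp)) hgrad hγ
        (fun t ht ↦ (hmem t ht).1) (fun t ht ↦ (hmem t ht).2) hfy
      rw [hγ0] at h3
      exact lt_irrefl _ ((h3.trans_lt hlen).trans_le (min_le_left _ _))
  refine ⟨e, he, hx, Metric.eball (ι m) (r / 2), Metric.isOpen_eball,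
    Metric.mem_eball_self (pos_iff_ne_zero.2 hr2), fun x hx ↦ (hballsub x hx).1, f,
    fun x hx ↦ ?_, fun x hx ↦ hf.contDiffAt (hU.mem_nhds (hballsub x hx).2), ?_,
    fun v hv ↦ ?_, fun v hv w ↦ ?_⟩
  · rw [halfSqDist, hdist x hx, ENNReal.toReal_ofReal (Real.sqrt_nonneg _),
      Real.sq_sqrt (mul_nonneg two_pos.le (hf0 _ (hballsub x hx).2))]
    ring
  · rw [hu₀]
    obtain ⟨v, hv, hvv⟩ := hgrad _ hu₀U
    rw [hfz _ hu₀U, mul_zero] at hvv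
    by_cases h : v = 0
    · rw [← hv, h, map_zero]
    · exact absurd hvv (hposW _ hu₀W v h).ne'
  · obtain ⟨a, ha⟩ := (htan v).1 hv
    rw [hu₀, ha]
    exact hT a
  · rw [hu₀, hN, ← hu₀, metricInChart_chartDeriv he hx]
    intro a
    obtain ⟨z, hz⟩ : ∃ z : TangentSpace 𝓘(ℝ, E) (ι m), chartDeriv e (ι m) z = J (a, 0) :=
      (mdifferentiable_of_mem_maximalAtlas he).mfderiv_surjective hx _
    rw [← hu₀, ← hz, metricInChart_chartDeriv he hx, real_inner_comm]
    exact hv z ((htan z).2 ⟨a, hz⟩)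

end Distance

/-! ### The Hessian in a chart -/

section HessianInChart

set_option maxSynthPendingDepth 5

variable {E : Type*} [NormedAddCommGroup E] [NormedSpace ℝ E] [FiniteDimensional ℝ E]
  {X : Type*} [EMetricSpace X] [ChartedSpace E X]
  [RiemannianBundle (fun x : X ↦ TangentSpace 𝓘(ℝ, E) x)] {e : OpenPartialHomeomorph X E}

/-- The Hessian of `f` read in the chart `e`, as an endomorphism of the model space. -/
noncomputable def hessianInChart (e : OpenPartialHomeomorph X E) (f : X → ℝ) (u a : E) : E :=
  fderiv ℝ (fieldInChart e (gradient f)) u a +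
    (metricInChart e u).inverse (christoffel e u a (fieldInChart e (gradient f) u))

variable [IsManifold 𝓘(ℝ, E) ∞ X]
  [IsContMDiffRiemannianBundle 𝓘(ℝ, E) ∞ E (fun x : X ↦ TangentSpace 𝓘(ℝ, E) x)]

/-- `hessianInChart` represents the Hessian. -/
lemma hessian_symmDeriv (he : e ∈ IsManifold.maximalAtlas 𝓘(ℝ, E) ∞ X) {u : E}
    (hu : u ∈ e.target) {f : X → ℝ} {O : Set X} (hO : IsOpen O) (huO : e.symm u ∈ O)
    (hf : ContMDiffOn 𝓘(ℝ, E) 𝓘(ℝ, ℝ) ∞ f O) (a : E) :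
    hessian f (e.symm u) (symmDeriv e u a) = symmDeriv e u (hessianInChart e f u a) := by
  have := FiniteDimensional.complete ℝ (TangentSpace 𝓘(ℝ, E) (e.symm u))
  rw [hessian_eq_leviCivitaIn he (e.map_target hu) hO huO hf, leviCivitaIn,
    chartDeriv_inverse he hu, chartDeriv_symmDeriv he hu, e.right_inv hu, hessianInChart, map_add,
    ← fieldInChart_apply]
  congr 1
  refine ext_inner_right ℝ fun w ↦ ?_
  obtain ⟨b, rfl⟩ := symmDeriv_surjective he hu w
  rw [InnerProductSpace.toDual_symm_apply, ← metricInChart_apply,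
    apply_inverse_of_posDef (metricInChart_pos he hu), ContinuousLinearMap.comp_apply,
    chartDeriv_symmDeriv he hu]

/-- The Hessian in a chart depends continuously on the point and on the vector. -/
lemma continuousOn_hessianInChart (he : e ∈ IsManifold.maximalAtlas 𝓘(ℝ, E) ∞ X)
    {f : X → ℝ} {O : Set X} (hO : IsOpen O) (hf : ContMDiffOn 𝓘(ℝ, E) 𝓘(ℝ, ℝ) ∞ f O) :
    ContinuousOn (fun q : E × E ↦ hessianInChart e f q.1 q.2)
      ((e.target ∩ e.symm ⁻¹' O) ×ˢ univ) := by
  have hopen : IsOpen (e.target ∩ e.symm ⁻¹' O) := e.isOpen_inter_preimage_symm hO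
  have hfst : MapsTo (Prod.fst : E × E → E) ((e.target ∩ e.symm ⁻¹' O) ×ˢ univ)
      (e.target ∩ e.symm ⁻¹' O) := fun q hq ↦ hq.1
  have hfst' : MapsTo (Prod.fst : E × E → E) ((e.target ∩ e.symm ⁻¹' O) ×ˢ univ)
      e.target := fun q hq ↦ hq.1.1
  have hY := contDiffOn_gradient he hO hf
  have hg := contDiffOn_metricInChart he
  have hY0 := hY.continuousOn.comp continuous_fst.continuousOn hfst
  have hY1 := (hY.continuousOn_fderiv_of_isOpen hopen (by simp)).comp
    continuous_fst.continuousOn hfst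
  have hg1 := (hg.continuousOn_fderiv_of_isOpen e.open_target (by simp)).comp
    continuous_fst.continuousOn hfst'
  have hinv := (contDiffOn_inverse_of_posDef hg fun q hq ↦
    metricInChart_pos he hq).continuousOn.comp continuous_fst.continuousOn hfst'
  refine (hY1.clm_apply continuous_snd.continuousOn).add (hinv.clm_apply ?_)
  refine continuousOn_clm_apply.2 fun b ↦ ?_
  have hconst : ContinuousOn (fun _ : E × E ↦ b) ((e.target ∩ e.symm ⁻¹' O) ×ˢ univ) :=
    continuousOn_const
  exact continuousOn_const.mul
    (((((hg1.clm_apply continuous_snd.continuousOn).clm_apply hY0).add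
      ((hg1.clm_apply hY0).clm_apply continuous_snd.continuousOn)).clm_apply hconst).sub
      (((hg1.clm_apply hconst).clm_apply continuous_snd.continuousOn).clm_apply hY0))

/-- At a critical point the Hessian is given by the second derivative in a chart. -/
lemma inner_hessian_of_fderiv_eq_zero (he : e ∈ IsManifold.maximalAtlas 𝓘(ℝ, E) ∞ X) {x : X}
    (hx : x ∈ e.source) {f : X → ℝ} {O : Set X} (hO : IsOpen O) (hxO : x ∈ O)
    (hf : ContMDiffOn 𝓘(ℝ, E) 𝓘(ℝ, ℝ) ∞ f O) {h : E → ℝ}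
    (hfh : ∀ᶠ u in 𝓝 (e x), f (e.symm u) = h u) (hcrit : fderiv ℝ h (e x) = 0)
    (v w : TangentSpace 𝓘(ℝ, E) x) :
    inner ℝ (hessian f x v) w =
      fderiv ℝ (fderiv ℝ h) (e x) (chartDeriv e x v) (chartDeriv e x w) := by
  rw [hessian_eq_leviCivitaIn he hx hO hxO hf, inner_leviCivitaIn he hx]
  have hmem : e x ∈ e.target ∩ e.symm ⁻¹' O := ⟨e.map_source hx, by
    rwa [mem_preimage, e.left_inv hx]⟩
  have hnhds := (e.isOpen_inter_preimage_symm hO).mem_nhds hmem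
  have hY : DifferentiableAt ℝ (fieldInChart e (gradient f)) (e x) :=
    ((contDiffOn_gradient he hO hf).contDiffAt hnhds).differentiableAt (by simp)
  have hg : DifferentiableAt ℝ (metricInChart e) (e x) :=
    ((contDiffOn_metricInChart he).contDiffAt
      (e.open_target.mem_nhds hmem.1)).differentiableAt (by simp)
  have hgY : ∀ᶠ u in 𝓝 (e x),
      fderiv ℝ h u = metricInChart e u (fieldInChart e (gradient f) u) := by
    filter_upwards [hnhds, hfh.eventually_nhds] with u hu hu'
    rw [metricInChart_gradient he hu.1
      ((hf.contMDiffAt (hO.mem_nhds hu.2)).mdifferentiableAt (by simp))]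
    exact (EventuallyEq.fderiv_eq hu').symm
  have hY0 : fieldInChart e (gradient f) (e x) = 0 := by
    by_contra hne
    have hpos := metricInChart_pos he hmem.1 _ hne
    rw [← hgY.self_of_nhds, hcrit] at hpos
    simp at hpos
  rw [EventuallyEq.fderiv_eq hgY, (hg.hasFDerivAt.clm_apply hY.hasFDerivAt).fderiv, covariantForm]
  simp [hY0]

end HessianInChart

/-! ### The Hessian of the distance function along the submanifold -/

section HessianHalfSqDist

lemma starProjection_orthogonal_add {V : Type*} [NormedAddCommGroup V] [InnerProductSpace ℝ V]
    {T : Submodule ℝ V} [Tᗮ.HasOrthogonalProjection] {s t : V} (hs : s ∈ T) (ht : t ∈ Tᗮ) :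
    Tᗮ.starProjection (s + t) = t := by
  rw [map_add, Submodule.starProjection_eq_self_iff.2 ht,
    Tᗮ.starProjection_apply_eq_zero_iff.2 (Submodule.le_orthogonal_orthogonal _ hs), zero_add]

variable {E : Type*} [NormedAddCommGroup E] [NormedSpace ℝ E] [FiniteDimensional ℝ E]
  {X : Type*} [EMetricSpace X] [ChartedSpace E X] [IsManifold 𝓘(ℝ, E) ∞ X]
  [RiemannianBundle (fun x : X ↦ TangentSpace 𝓘(ℝ, E) x)]
  [IsContMDiffRiemannianBundle 𝓘(ℝ, E) ∞ E (fun x : X ↦ TangentSpace 𝓘(ℝ, E) x)]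
  [IsRiemannianManifold 𝓘(ℝ, E) X]
  {F : Type*} [NormedAddCommGroup F] [NormedSpace ℝ F] [FiniteDimensional ℝ F]
  {M : Type*} [TopologicalSpace M] [ChartedSpace F M] {ι : M → X}

/-- Near the submanifold half the squared distance is smooth, and its Hessian at points of the
submanifold is the projection onto the normal space. -/
lemma exists_contMDiffOn_halfSqDist (hι : IsSmoothEmbedding 𝓘(ℝ, F) 𝓘(ℝ, E) ∞ ι) (m : M) :
    ∃ O : Set X, IsOpen O ∧ ι m ∈ O ∧
      ContMDiffOn 𝓘(ℝ, E) 𝓘(ℝ, ℝ) ∞ (halfSqDist (range ι)) O ∧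
      ∀ v : TangentSpace 𝓘(ℝ, E) (ι m), hessian (halfSqDist (range ι)) (ι m) v =
        (tangentOf (F := F) ι m)ᗮ.starProjection v := by
  obtain ⟨e, he, hm, O, hO, hmO, hOe, f, hf, hfs, hcrit, htan, hnor⟩ := exists_halfSqDist_eq hι m
  have hsmooth : ContMDiffOn 𝓘(ℝ, E) 𝓘(ℝ, ℝ) ∞ (halfSqDist (range ι)) O := by
    intro x hx
    have h1 := (hfs x hx).contMDiffAt.comp x
      ((contMDiffOn_of_mem_maximalAtlas he).contMDiffAt (e.open_source.mem_nhds (hOe hx)))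
    refine (h1.congr_of_eventuallyEq ?_).contMDiffWithinAt
    filter_upwards [hO.mem_nhds hx] with y hy using hf y hy
  refine ⟨O, hO, hmO, hsmooth, fun v ↦ ext_inner_right ℝ fun w ↦ ?_⟩
  have hfh : ∀ᶠ u in 𝓝 (e (ι m)), halfSqDist (range ι) (e.symm u) = f u := by
    have hmem : e (ι m) ∈ e.target ∩ e.symm ⁻¹' O := ⟨e.map_source hm, by
      rwa [mem_preimage, e.left_inv hm]⟩
    filter_upwards [(e.isOpen_inter_preimage_symm hO).mem_nhds hmem] with u hu
    rw [hf _ hu.2, e.right_inv hu.1]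
  rw [inner_hessian_of_fderiv_eq_zero he hm hO hmO hsmooth hfh hcrit]
  obtain ⟨s, hs, t, ht, rfl⟩ := (tangentOf (F := F) ι m).exists_add_mem_mem_orthogonal v
  have hproj : (tangentOf (F := F) ι m)ᗮ.starProjection (s + t) = t :=
    starProjection_orthogonal_add hs ht
  rw [hproj, map_add, map_add, add_apply, htan s hs, hnor t ht w, zero_apply, zero_add]

end HessianHalfSqDist

/-! ### Forms of comass one -/

section FirstCousin

variable {V : Type*} [NormedAddCommGroup V] [InnerProductSpace ℝ V] {p : ℕ}
  {φ : V [⋀^Fin p]→ₗ[ℝ] ℝ} {v : Fin p → V}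

/-- The first cousin principle: rotating a vector of a `φ`-plane towards a direction orthogonal to
the plane does not change `φ` to first order, as `φ` is maximal at the plane. -/
lemma apply_update_eq_zero_of_orthogonal (hφ : ∀ v : Fin p → V, Orthonormal ℝ v → φ v ≤ 1)
    (hv : Orthonormal ℝ v) (hφv : φ v = 1) (i : Fin p) {w : V} (hw : ∀ j, inner ℝ (v j) w = 0) :
    φ (Function.update v i w) = 0 := by
  set c := φ (Function.update v i w) with hc
  by_contra hne
  -- with this `t`, `φ` would exceed `1` at the normalization of `v i + t • w`
  set t := c / (‖w‖ ^ 2 + 1) with ht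
  set z := v i + t • w with hz
  have hzz : inner ℝ z z = 1 + t ^ 2 * ‖w‖ ^ 2 := by
    have h1 : inner ℝ (v i) (v i) = (1 : ℝ) := by
      rw [real_inner_self_eq_norm_sq, hv.1 i, one_pow]
    have h2 : inner ℝ w (v i) = (0 : ℝ) := by rw [real_inner_comm, hw i]
    rw [hz, inner_add_left, inner_add_right, inner_add_right, real_inner_smul_left,
      real_inner_smul_left, real_inner_smul_right, real_inner_smul_right, h1, h2, hw i,
      real_inner_self_eq_norm_sq]
    ring
  have hz2 : ‖z‖ ^ 2 = 1 + t ^ 2 * ‖w‖ ^ 2 := by rw [← real_inner_self_eq_norm_sq, hzz]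
  have hzpos : 0 < ‖z‖ := by
    refine norm_pos_iff.2 fun h ↦ ?_
    rw [h, norm_zero] at hz2
    nlinarith [sq_nonneg (t * ‖w‖)]
  have hvz : ∀ j, j ≠ i → inner ℝ (v j) z = (0 : ℝ) := by
    intro j hj
    rw [hz, inner_add_right, real_inner_smul_right, hw j, hv.2 hj]
    ring
  have horth : Orthonormal ℝ (Function.update v i (‖z‖⁻¹ • z)) := by
    refine ⟨fun j ↦ ?_, fun j k hjk ↦ ?_⟩
    · rcases eq_or_ne j i with rfl | hj
      · rw [Function.update_self, norm_smul, norm_inv, norm_norm, inv_mul_cancel₀ hzpos.ne']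
      · rw [Function.update_of_ne hj, hv.1 j]
    · rcases eq_or_ne j i with rfl | hj
      · rw [Function.update_self, Function.update_of_ne hjk.symm, real_inner_smul_left,
          real_inner_comm, hvz k hjk.symm, mul_zero]
      · rcases eq_or_ne k i with rfl | hk
        · rw [Function.update_self, Function.update_of_ne hj, real_inner_smul_right, hvz j hj,
            mul_zero]
        · rw [Function.update_of_ne hj, Function.update_of_ne hk, hv.2 hjk]
  have hle := hφ _ horth
  rw [φ.map_update_smul, hz, φ.map_update_add, φ.map_update_smul, Function.update_eq_self, hφv,
    ← hc, ← hz, smul_eq_mul, smul_eq_mul, inv_mul_le_iff₀ hzpos, mul_one] at hle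
  have hN : 0 < ‖w‖ ^ 2 + 1 := by positivity
  have hctN : c = t * (‖w‖ ^ 2 + 1) := by rw [ht]; field_simp
  have ht0 : t ≠ 0 := fun h ↦ hne (by rw [hctN, h, zero_mul])
  have ht2 : 0 < t ^ 2 := by positivity
  rw [hctN] at hle
  have h0 : 0 ≤ 1 + t * (t * (‖w‖ ^ 2 + 1)) := by nlinarith
  have hsq := pow_le_pow_left₀ h0 hle 2
  rw [hz2] at hsq
  nlinarith [mul_pos ht2 hN, sq_nonneg (t * (t * (‖w‖ ^ 2 + 1)))]

/-- Replacing a vector of a `φ`-plane by `a` only sees the component of `a` along that vector: the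
components along the others are killed as `φ` is alternating, the normal one by the first cousin
principle. -/
lemma apply_update_eq_inner (hφ : ∀ v : Fin p → V, Orthonormal ℝ v → φ v ≤ 1)
    (hv : Orthonormal ℝ v) (hφv : φ v = 1) (i : Fin p) (a : V) :
    φ (Function.update v i a) = inner ℝ (v i) a := by
  have hw : ∀ j, inner ℝ (v j) (a - ∑ k, (inner ℝ (v k) a : ℝ) • v k) = (0 : ℝ) := by
    intro j
    rw [inner_sub_right, hv.inner_right_fintype, sub_self]
  have h := apply_update_eq_zero_of_orthogonal hφ hv hφv i hw
  rw [φ.map_update_sub, φ.map_update_sum, sub_eq_zero] at h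
  rw [h, Finset.sum_eq_single i]
  · rw [φ.map_update_smul, Function.update_eq_self, hφv, smul_eq_mul, mul_one]
  · intro j _ hj
    rw [φ.map_update_smul, φ.map_update_self v hj.symm, smul_zero]
  · simp

end FirstCousin

/-! ### Plurisubharmonicity along the submanifold -/

section PSH

variable {E : Type*} [NormedAddCommGroup E] [NormedSpace ℝ E] [FiniteDimensional ℝ E]
  {X : Type*} [EMetricSpace X] [ChartedSpace E X]
  [RiemannianBundle (fun x : X ↦ TangentSpace 𝓘(ℝ, E) x)]
  {p : ℕ} {φ : ∀ x : X, TangentSpace 𝓘(ℝ, E) x [⋀^Fin p]→L[ℝ] ℝ}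

/-- On `φ`-planes the `φ`-Hessian is the trace of the Hessian restricted to the plane. -/
lemma IsCalibration.phiHessian_eq_sum (hφ : IsCalibration φ) {f : X → ℝ} {x : X}
    {v : Fin p → TangentSpace 𝓘(ℝ, E) x} (hv : IsPhiPlane φ x v) :
    phiHessian φ f x v = ∑ i, inner ℝ (v i) (hessian f x (v i)) := by
  rw [phiHessian, derivationAction]
  exact Finset.sum_congr rfl fun i _ ↦ apply_update_eq_inner (φ := (φ x).toAlternatingMap)
    (hφ.le_one x) hv.1 hv.2 i (hessian f x (v i))

/-- If the Hessian is the projection onto `Tᗮ` then the `φ`-Hessian is positive exactly on the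
`φ`-planes that are not contained in `T`. -/
lemma IsCalibration.phiHessian_pos_iff (hφ : IsCalibration φ) {f : X → ℝ} {x : X}
    {T : Submodule ℝ (TangentSpace 𝓘(ℝ, E) x)} (hf : ∀ v, hessian f x v = Tᗮ.starProjection v)
    {v : Fin p → TangentSpace 𝓘(ℝ, E) x} (hv : IsPhiPlane φ x v) :
    0 < phiHessian φ f x v ↔ ¬ Submodule.span ℝ (range v) ≤ T := by
  have hsum : phiHessian φ f x v = ∑ i, ‖Tᗮ.starProjection (v i)‖ ^ 2 := by
    rw [hφ.phiHessian_eq_sum hv]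
    refine Finset.sum_congr rfl fun i _ ↦ ?_
    rw [hf, real_inner_comm]
    exact Tᗮ.re_inner_starProjection_eq_normSq (v i)
  have hmem : ∀ i, ‖Tᗮ.starProjection (v i)‖ ^ 2 = 0 ↔ v i ∈ T := fun i ↦ by
    rw [sq_eq_zero_iff, norm_eq_zero, Submodule.starProjection_apply_eq_zero_iff,
      Submodule.orthogonal_orthogonal]
  have hnn : 0 ≤ phiHessian φ f x v := hsum ▸ Finset.sum_nonneg fun i _ ↦ sq_nonneg _
  rw [hnn.lt_iff_ne', not_iff_not, hsum, Finset.sum_eq_zero_iff_of_nonneg fun i _ ↦ sq_nonneg _,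
    Submodule.span_le, range_subset_iff]
  simp only [hmem, Finset.mem_univ, true_imp_iff, SetLike.mem_coe]

end PSH

/-! ### Openness of strict plurisubharmonicity -/

section Openness

set_option maxSynthPendingDepth 5

variable {E : Type*} [NormedAddCommGroup E] [NormedSpace ℝ E]
  {X : Type*} [EMetricSpace X] [ChartedSpace E X]
  {p : ℕ} {φ : ∀ x : X, TangentSpace 𝓘(ℝ, E) x [⋀^Fin p]→L[ℝ] ℝ} {f : X → ℝ}
  {e : OpenPartialHomeomorph X E}

lemma formInChart_apply (φ : ∀ x : X, TangentSpace 𝓘(ℝ, E) x [⋀^Fin p]→L[ℝ] ℝ)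
    (e : OpenPartialHomeomorph X E) (u : E) (a : Fin p → E) :
    formInChart φ e u a = φ (e.symm u) (symmDeriv e u ∘ a) := rfl

variable [RiemannianBundle (fun x : X ↦ TangentSpace 𝓘(ℝ, E) x)]

lemma orthonormal_symmDeriv_iff {u : E} {a : Fin p → E} :
    Orthonormal ℝ (symmDeriv e u ∘ a) ↔
      ∀ i j, metricInChart e u (a i) (a j) = if i = j then 1 else 0 :=
  orthonormal_iff_ite

variable [FiniteDimensional ℝ E] [IsManifold 𝓘(ℝ, E) ∞ X]
  [IsContMDiffRiemannianBundle 𝓘(ℝ, E) ∞ E (fun x : X ↦ TangentSpace 𝓘(ℝ, E) x)]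

lemma phiHessian_symmDeriv (he : e ∈ IsManifold.maximalAtlas 𝓘(ℝ, E) ∞ X) {u : E}
    (hu : u ∈ e.target) {O : Set X} (hO : IsOpen O) (huO : e.symm u ∈ O)
    (hf : ContMDiffOn 𝓘(ℝ, E) 𝓘(ℝ, ℝ) ∞ f O) (a : Fin p → E) :
    phiHessian φ f (e.symm u) (symmDeriv e u ∘ a) =
      ∑ i, formInChart φ e u (Function.update a i (hessianInChart e f u (a i))) := by
  rw [phiHessian, derivationAction]
  refine Finset.sum_congr rfl fun i _ ↦ ?_
  rw [formInChart_apply, Function.comp_update, ← hessian_symmDeriv he hu hO huO hf]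
  rfl

/-- Near a point of a chart, the vectors of unit length are bounded in the norm of the model
space. -/
lemma exists_norm_le_of_metricInChart_eq_one (he : e ∈ IsManifold.maximalAtlas 𝓘(ℝ, E) ∞ X)
    {u₀ : E} (hu₀ : u₀ ∈ e.target) :
    ∃ R, ∀ᶠ u in 𝓝 u₀, ∀ a, metricInChart e u a a = 1 → ‖a‖ ≤ R := by
  obtain ⟨K, hK, hKb⟩ : ∃ K, 0 ≤ K ∧ ∀ a, ‖a‖ ^ 2 ≤ K ^ 2 * metricInChart e u₀ a a := by
    refine ⟨‖chartDeriv e (e.symm u₀)‖, norm_nonneg _, fun a ↦ ?_⟩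
    have h := (chartDeriv e (e.symm u₀)).le_opNorm (symmDeriv e u₀ a)
    rw [chartDeriv_symmDeriv he hu₀] at h
    rw [metricInChart_apply, real_inner_self_eq_norm_sq, ← mul_pow]
    exact pow_le_pow_left₀ (norm_nonneg _) h 2
  have hε : 0 < 1 / (2 * (K ^ 2 + 1)) := by positivity
  have hg := ((contDiffOn_metricInChart he).contDiffAt (e.open_target.mem_nhds hu₀)).continuousAt
  refine ⟨2 * K, ?_⟩
  filter_upwards [hg.eventually (Metric.closedBall_mem_nhds _ hε)] with u hu a ha
  rw [dist_eq_norm'] at hu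
  have h1 : metricInChart e u₀ a a - 1 ≤ 1 / (2 * (K ^ 2 + 1)) * ‖a‖ * ‖a‖ := by
    have h2 := (metricInChart e u₀ - metricInChart e u).le_of_opNorm₂_le_of_le hu le_rfl
      (le_refl ‖a‖) (x := a) (y := a)
    have h3 := (le_abs_self _).trans h2
    simpa [ha] using h3
  have h4 : K ^ 2 * (1 / (2 * (K ^ 2 + 1))) ≤ 1 / 2 := by
    rw [mul_one_div, div_le_div_iff₀ (by positivity) two_pos]
    nlinarith
  have h5 := hKb a
  refine abs_le_of_sq_le_sq' ?_ (by positivity) |>.2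
  nlinarith [mul_le_mul_of_nonneg_left h1 (sq_nonneg K),
    mul_le_mul_of_nonneg_right h4 (sq_nonneg ‖a‖)]

/-- Strict plurisubharmonicity is an open condition, because the `φ`-planes over a compact
neighbourhood form a compact set. -/
lemma eventually_strictlyPSHAt_symm (he : e ∈ IsManifold.maximalAtlas 𝓘(ℝ, E) ∞ X)
    (hφ : ContinuousOn (formInChart φ e) e.target) {u₀ : E} (hu₀ : u₀ ∈ e.target)
    (hf : StrictlyPSHAt φ f (e.symm u₀)) : ∀ᶠ u in 𝓝 u₀, StrictlyPSHAt φ f (e.symm u) := by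
  obtain ⟨O, hOf, hO, hxO⟩ := eventually_nhds_iff.1 hf.1
  have hfO : ContMDiffOn 𝓘(ℝ, E) 𝓘(ℝ, ℝ) ∞ f O := fun x hx ↦ (hOf x hx).contMDiffWithinAt
  have hW : IsOpen (e.target ∩ e.symm ⁻¹' O) := e.isOpen_inter_preimage_symm hO
  have hu₀W : u₀ ∈ e.target ∩ e.symm ⁻¹' O := ⟨hu₀, hxO⟩
  obtain ⟨R, hR⟩ := exists_norm_le_of_metricInChart_eq_one he hu₀
  -- the condition that the tuple `a`, read in the chart, is not a `φ`-plane violating positivity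
  let P : E → (Fin p → E) → Prop := fun u a ↦
    (∀ i j, metricInChart e u (a i) (a j) = if i = j then 1 else 0) → formInChart φ e u a = 1 →
      0 < ∑ i, formInChart φ e u (Function.update a i (hessianInChart e f u (a i)))
  have hcontφ : ∀ a, ContinuousAt (fun q : E × (Fin p → E) ↦ formInChart φ e q.1) (u₀, a) :=
    fun a ↦ ContinuousAt.comp (f := Prod.fst) (g := formInChart φ e) (x := (u₀, a))
      (hφ.continuousAt (e.open_target.mem_nhds hu₀)) continuousAt_fst
  have hcontg : ∀ a, ContinuousAt (fun q : E × (Fin p → E) ↦ metricInChart e q.1) (u₀, a) :=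
    fun a ↦ ContinuousAt.comp (f := Prod.fst) (g := metricInChart e) (x := (u₀, a))
      ((contDiffOn_metricInChart he).continuousOn.continuousAt (e.open_target.mem_nhds hu₀))
      continuousAt_fst
  have hP : ∀ a, ∀ᶠ q : E × (Fin p → E) in 𝓝 (u₀, a), P q.1 q.2 := by
    intro a
    have hcoord : ∀ i, ContinuousAt (fun q : E × (Fin p → E) ↦ q.2 i) (u₀, a) := fun i ↦
      ((continuous_apply i).comp continuous_snd).continuousAt
    by_cases h1 : ∀ i j, metricInChart e u₀ (a i) (a j) = if i = j then 1 else 0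
    · by_cases h2 : formInChart φ e u₀ a = 1
      · have hpos : 0 < ∑ i, formInChart φ e u₀
            (Function.update a i (hessianInChart e f u₀ (a i))) := by
          rw [← phiHessian_symmDeriv he hu₀ hO hxO hfO]
          exact hf.2 _ ⟨orthonormal_symmDeriv_iff.2 h1, h2⟩
        have hcont : ContinuousAt (fun q : E × (Fin p → E) ↦ ∑ i, formInChart φ e q.1
            (Function.update q.2 i (hessianInChart e f q.1 (q.2 i)))) (u₀, a) := by
          refine tendsto_finsetSum _ fun i _ ↦ ?_
          have hh : ContinuousAt (fun q : E × (Fin p → E) ↦ hessianInChart e f q.1 (q.2 i))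
              (u₀, a) :=
            ContinuousAt.comp (f := fun q : E × (Fin p → E) ↦ (q.1, q.2 i))
              (g := fun q : E × E ↦ hessianInChart e f q.1 q.2)
              ((continuousOn_hessianInChart he hO hfO).continuousAt
                ((hW.prod isOpen_univ).mem_nhds ⟨hu₀W, mem_univ _⟩))
              (continuousAt_fst.prodMk (hcoord i))
          exact (hcontφ a).eval (continuousAt_snd.update i hh)
        filter_upwards [hcont.eventually (lt_mem_nhds hpos)] with q hq _ _ using hq
      · have hcont : ContinuousAt (fun q : E × (Fin p → E) ↦ formInChart φ e q.1 q.2) (u₀, a) :=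
          (hcontφ a).eval continuousAt_snd
        filter_upwards [hcont.eventually (isOpen_ne.mem_nhds h2)] with q hq _ h using absurd h hq
    · push Not at h1
      obtain ⟨i, j, hij⟩ := h1
      have hcont : ContinuousAt (fun q : E × (Fin p → E) ↦ metricInChart e q.1 (q.2 i) (q.2 j))
          (u₀, a) := ((hcontg a).clm_apply (hcoord i)).clm_apply (hcoord j)
      filter_upwards [hcont.eventually (isOpen_ne.mem_nhds hij)] with q hq h using
        absurd (h i j) hq
  have hall := (isCompact_closedBall (0 : Fin p → E) |R|).eventually_forall_of_forall_eventually
    fun a _ ↦ hP a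
  filter_upwards [hall, hR, hW.mem_nhds hu₀W] with u hu huR huW
  refine ⟨eventually_nhds_iff.2 ⟨O, hOf, hO, huW.2⟩, fun v hv ↦ ?_⟩
  obtain ⟨a, rfl⟩ : ∃ a : Fin p → E, v = symmDeriv e u ∘ a :=
    ⟨fun i ↦ chartDeriv e (e.symm u) (v i), funext fun i ↦
      (symmDeriv_chartDeriv he huW.1 (v i)).symm⟩
  have horth := orthonormal_symmDeriv_iff.1 hv.1
  rw [phiHessian_symmDeriv he huW.1 hO huW.2 hfO]
  refine hu a ?_ horth hv.2
  rw [mem_closedBall_zero_iff, pi_norm_le_iff_of_nonneg (abs_nonneg R)]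
  exact fun i ↦ (huR (a i) (by rw [horth, if_pos rfl])).trans (le_abs_self R)

lemma StrictlyPSHAt.eventually {x : X} (hf : StrictlyPSHAt φ f x) (hφ : IsSmoothForm φ) :
    ∀ᶠ y in 𝓝 x, StrictlyPSHAt φ f y := by
  have hx : x ∈ (chartAt E x).source := mem_chart_source E x
  have h := eventually_strictlyPSHAt_symm (f := f) (IsManifold.chart_mem_maximalAtlas x)
    (hφ _ (chart_mem_atlas E x)).continuousOn ((chartAt E x).map_source hx)
    (by rwa [(chartAt E x).left_inv hx])
  filter_upwards [((chartAt E x).continuousAt hx).eventually h,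
    (chartAt E x).open_source.mem_nhds hx] with y hy hys
  rwa [(chartAt E x).left_inv hys] at hy

end Openness

end CalibratedGeometry

theorem theorem7p2
    {E : Type*} [NormedAddCommGroup E] [NormedSpace ℝ E] [FiniteDimensional ℝ E]
    {X : Type*} [EMetricSpace X] [ChartedSpace E X] [IsManifold 𝓘(ℝ, E) ∞ X]
    [RiemannianBundle (fun x : X ↦ TangentSpace 𝓘(ℝ, E) x)]
    [IsContMDiffRiemannianBundle 𝓘(ℝ, E) ∞ E (fun x : X ↦ TangentSpace 𝓘(ℝ, E) x)]
    [IsRiemannianManifold 𝓘(ℝ, E) X]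
    {p : ℕ} (hp : 1 ≤ p)
    (φ : ∀ x : X, TangentSpace 𝓘(ℝ, E) x [⋀^Fin p]→L[ℝ] ℝ) (hφ : IsCalibration φ)
    {F : Type*} [NormedAddCommGroup F] [NormedSpace ℝ F] [FiniteDimensional ℝ F]
    {M : Type*} [TopologicalSpace M] [ChartedSpace F M] [IsManifold 𝓘(ℝ, F) ∞ M]
    (ι : M → X) (hι : IsSmoothEmbedding 𝓘(ℝ, F) 𝓘(ℝ, E) ∞ ι) (hclosed : IsClosed (range ι)) :
    (∃ U : Set X, IsOpen U ∧ range ι ⊆ U ∧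
      ContMDiffOn 𝓘(ℝ, E) 𝓘(ℝ, ℝ) ∞ (halfSqDist (range ι)) U) ∧
    (∀ (m : M) (v : TangentSpace 𝓘(ℝ, E) (ι m)),
      hessian (halfSqDist (range ι)) (ι m) v = (tangentOf (F := F) ι m)ᗮ.starProjection v) ∧
    (IsPhiFree (F := F) φ ι ↔ ∀ x ∈ range ι, StrictlyPSHAt φ (halfSqDist (range ι)) x) ∧
    (IsPhiFree (F := F) φ ι ↔ ∃ U : Set X, IsOpen U ∧ range ι ⊆ U ∧
      ∀ x ∈ U, StrictlyPSHAt φ (halfSqDist (range ι)) x) := by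
  have hpart1 : ∃ U : Set X, IsOpen U ∧ range ι ⊆ U ∧
      ContMDiffOn 𝓘(ℝ, E) 𝓘(ℝ, ℝ) ∞ (halfSqDist (range ι)) U := by
    choose O hO hmem hsmooth _ using exists_contMDiffOn_halfSqDist hι
    refine ⟨⋃ m, O m, isOpen_iUnion hO, range_subset_iff.2 fun m ↦ mem_iUnion.2 ⟨m, hmem m⟩, ?_⟩
    intro x hx
    obtain ⟨m, hm⟩ := mem_iUnion.1 hx
    exact ((hsmooth m).contMDiffAt ((hO m).mem_nhds hm)).contMDiffWithinAt
  have hhess : ∀ (m : M) (v : TangentSpace 𝓘(ℝ, E) (ι m)), hessian (halfSqDist (range ι)) (ι m) v =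
      (tangentOf (F := F) ι m)ᗮ.starProjection v := by
    intro m
    obtain ⟨_, _, _, _, h⟩ := exists_contMDiffOn_halfSqDist hι m
    exact h
  have hpart2 : IsPhiFree (F := F) φ ι ↔
      ∀ x ∈ range ι, StrictlyPSHAt φ (halfSqDist (range ι)) x := by
    constructor
    · rintro hfree _ ⟨m, rfl⟩
      obtain ⟨O, hO, hm, hs, _⟩ := exists_contMDiffOn_halfSqDist hι m
      refine ⟨?_, fun v hv ↦ (hφ.phiHessian_pos_iff (hhess m) hv).2 (hfree m v hv)⟩
      filter_upwards [hO.mem_nhds hm] with y hy using hs.contMDiffAt (hO.mem_nhds hy)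
    · intro h m v hv
      exact (hφ.phiHessian_pos_iff (hhess m) hv).1 ((h _ (mem_range_self m)).2 v hv)
  refine ⟨hpart1, hhess, hpart2, hpart2.trans ⟨fun h ↦ ?_, ?_⟩⟩
  · refine ⟨interior {x | StrictlyPSHAt φ (halfSqDist (range ι)) x}, isOpen_interior, ?_,
      fun x hx ↦ interior_subset (s := {x | StrictlyPSHAt φ (halfSqDist (range ι)) x}) hx⟩
    exact fun x hx ↦ mem_interior_iff_mem_nhds.2 ((h x hx).eventually hφ.smooth)
  · rintro ⟨U, _, hU, h⟩ x hx
    exact h x (hU hx)
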